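/- Fix constants $L>0$, $\bar L>0$, $\sigma>0$, $G$, $\mathcal K$. There is a constant $\mathcal B>0$, depending only on $L,\bar L,\sigma,G,\mathcal K$ (and so not on $T,d,\alpha,n,\rho$), such that the following holds for all integers $d,n,T\ge 1$ and all $\alpha>0$. Let $f_1,\dots,f_n:\mathbb R^d\to\mathbb R$ be differentiable functions with $|f_i(z)-f_i(x)-\langle\nabla f_i(x),z-x\rangle|\le L\|z-x\|^2$ and $\|\nabla f_i(x)-\nabla f_i(z)\|\le\bar L\|x-z\|$ for all $x,z\in\mathbb R^d$, and let $f=\frac1n\sum_{i=1}^n f_i$ be $\alpha$-strongly convex, i.e. $f(x)-f(x')\ge\langle\nabla f(x'),x-x'\rangle+\frac\alpha2\|x-x'\|^2$ for all $x,x'\in\mathbb R^d$. Let $\Theta\subset\mathbb R^d$ be a nonempty convex compact set with $\mathrm{diam}(\Theta)\le\mathcal K$ and $\max_{x\in\Theta}\|\nabla f_i(x)\|\le G$ for every $i$, and let $x^*$ be the minimizer of $f$ over $\Theta$. Let $W\in\mathbb R^{n\times n}$ be symmetric and doubly stochastic with $\rho:=\|W-n^{-1}\mathbf 1\mathbf 1^\top\|_*<1$,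 where $\|\cdot\|_*$ is the spectral norm. Put $\eta_t=\frac1{\alpha t}$ and $h_t=\Big(\frac{3d^2\sigma^2}{2L\alpha t+9L^2d^2}\Big)^{1/4}$. Starting from a common (possibly random) point $x^1(1)=\dots=x^n(1)\in\Theta$, let, for $1\le t<T$ and $1\le i\le n$, $$x^i(t+1)=\sum_{k=1}^n W_{ik}\,\mathrm{Proj}_\Theta\big(x^k(t)-\eta_t g^k(t)\big),\qquad g^i(t)=\frac{d}{2h_t}\big(y_i(t)-y_i'(t)\big)\zeta_i(t),$$ $$y_i(t)=f_i\big(x^i(t)+h_t\zeta_i(t)\big)+\xi_i(t),\qquad y_i'(t)=f_i\big(x^i(t)-h_t\zeta_i(t)\big)+\xi_i'(t),$$ where $\mathrm{Proj}_\Theta$ is the Euclidean projection onto $\Theta$, the $\zeta_i(t)$, $1\le i\le n$, $1\le t\le T$, are i.i.d. uniformly distributed on the unit Euclidean sphere of $\mathbb R^d$, each $\zeta_i(t)$ is independent of the collection formed by $\xi_i(t)$, $\xi_i'(t)$ and the iterates $x^1(t),\dots,x^n(t)$, and the noises $\xi_i(t),\xi_i'(t)$ (which need neither be centered nor independent of each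 other) satisfy $\mathbb E[\xi_i(t)^2]\le\sigma^2$ and $\mathbb E[\xi_i'(t)^2]\le\sigma^2$. Let $\bar x(t)=\frac1n\sum_{i=1}^n x^i(t)$ and $\tilde x(T)=\frac1{T-\lfloor T/2\rfloor}\sum_{t=\lfloor T/2\rfloor+1}^{T}\bar x(t)$. Then $$\mathbb E\big[f(\tilde x(T))-f(x^*)\big]\le\frac{\mathcal B}{1-\rho}\left(\frac{d}{\sqrt{\alpha T}}+\frac{d^2}{\alpha T}\right).$$ The bound holds both when $\lfloor T/2\rfloor$ denotes the integer part of $T/2$ and when it denotes the largest integer strictly smaller than $T/2$. -/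

import Mathlib

open MeasureTheory ProbabilityTheory

/-- `ℝ^d` with its Euclidean inner product and norm. -/
abbrev Euc (d : ℕ) : Type := EuclideanSpace ℝ (Fin d)

/-- The Hölder class `F_2(L)`. For `β = 2` the order `ℓ` of the Taylor polynomial is the largest
integer strictly smaller than `β`, that is `ℓ = 1`: the function is differentiable and its first
order Taylor polynomial at `x` approximates it at `z` up to `L ‖z - x‖ ^ 2`. -/
def IsHolderTwo {d : ℕ} (L : ℝ) (f : Euc d → ℝ) : Prop :=
  Differentiable ℝ f ∧
    ∀ x z : Euc d, |f z - (f x + inner ℝ (gradient f x) (z - x))| ≤ L * ‖z - x‖ ^ 2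

/-- `f` is 2-smooth with constant `Lbar`. -/
def IsTwoSmooth {d : ℕ} (Lbar : ℝ) (f : Euc d → ℝ) : Prop :=
  Differentiable ℝ f ∧
    ∀ x x' : Euc d, ‖gradient f x - gradient f x'‖ ≤ Lbar * ‖x - x'‖

/-- `f` is (differentiable and) `α`-strongly convex on `ℝ^d`. -/
def IsStronglyConvex {d : ℕ} (α : ℝ) (f : Euc d → ℝ) : Prop :=
  Differentiable ℝ f ∧
    ∀ x x' : Euc d,
      inner ℝ (gradient f x') (x - x') + α / 2 * ‖x - x'‖ ^ 2 ≤ f x - f x'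

/-- The average objective `f = n⁻¹ ∑ i, f i`. -/
noncomputable def avgObjective {d n : ℕ} (f : Fin n → Euc d → ℝ) (x : Euc d) : ℝ :=
  (1 / (n : ℝ)) * ∑ i, f i x

/-- The spectral norm of a real square matrix: its operator norm for the Euclidean norm. -/
noncomputable def spectralNorm2 {n : ℕ} (A : Matrix (Fin n) (Fin n) ℝ) : ℝ :=
  ‖Matrix.toEuclideanCLM (n := Fin n) (𝕜 := ℝ) A‖

/-- `ρ = ‖W - n⁻¹ 𝟏 𝟏ᵀ‖_*`. -/
noncomputable def networkRho {n : ℕ} (W : Matrix (Fin n) (Fin n) ℝ) : ℝ :=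
  spectralNorm2 (W - Matrix.of fun _ _ => 1 / (n : ℝ))

/-- The consensus matrix is symmetric, doubly stochastic, and `ρ < 1`. -/
structure IsConsensusMatrix {n : ℕ} (W : Matrix (Fin n) (Fin n) ℝ) : Prop where
  symm : W.IsSymm
  doubly_stochastic : W ∈ doublyStochastic ℝ (Fin n)
  rho_lt_one : networkRho W < 1

/-- The Euclidean projection `argmin {‖z - v‖ : z ∈ Θ}` (used for nonempty closed convex `Θ`,
where the minimizer exists and is unique). -/
noncomputable def euclProj {d : ℕ} (Θ : Set (Euc d)) (v : Euc d) : Euc d :=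
  Classical.epsilon fun p => p ∈ Θ ∧ ∀ z ∈ Θ, ‖p - v‖ ≤ ‖z - v‖

/-- The defining property of the projection holds on nonempty compact sets. -/
theorem euclProj_spec {d : ℕ} {Θ : Set (Euc d)} (hc : IsCompact Θ) (hne : Θ.Nonempty)
    (v : Euc d) : euclProj Θ v ∈ Θ ∧ ∀ z ∈ Θ, ‖euclProj Θ v - v‖ ≤ ‖z - v‖ := by
  have h : ∃ p, p ∈ Θ ∧ ∀ z ∈ Θ, ‖p - v‖ ≤ ‖z - v‖ := by
    obtain ⟨p, hp, hmin⟩ := hc.exists_isMinOn hne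
      (f := fun z : Euc d => ‖z - v‖) (by fun_prop)
    exact ⟨p, hp, fun z hz => hmin hz⟩
  exact Classical.epsilon_spec h

/-- The uniform probability distribution on the unit Euclidean sphere, as a measure on `ℝ^d`:
the normalized surface measure (for `d = 1`, the uniform distribution on `{-1, 1}`). -/
noncomputable def uniformUnitSphere (d : ℕ) : Measure (Euc d) :=
  (((volume : Measure (Euc d)).toSphere Set.univ)⁻¹ •
    (volume : Measure (Euc d)).toSphere).map Subtype.val

/-- The 2-point gradient estimator `d / (2h) (y - y') ζ`, where `y = F (x + h ζ) + ξ` and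
`y' = F (x - h ζ) + ξ'`. -/
noncomputable def gradEstimator {d : ℕ} (F : Euc d → ℝ) (h : ℝ) (x ζ : Euc d) (ξ ξ' : ℝ) :
    Euc d :=
  ((d : ℝ) / (2 * h) * ((F (x + h • ζ) + ξ) - (F (x - h • ζ) + ξ'))) • ζ

/-- The step size `η_t = 1 / (α t)`. -/
noncomputable def stepSize (α : ℝ) (t : ℕ) : ℝ := 1 / (α * t)

/-- The smoothing parameter `h_t = (3 d² σ² / (2 L α t + 9 L² d²)) ^ (1/4)`. -/
noncomputable def smoothingParam (d : ℕ) (L α σ : ℝ) (t : ℕ) : ℝ :=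
  (3 * (d : ℝ) ^ 2 * σ ^ 2 / (2 * L * α * t + 9 * L ^ 2 * (d : ℝ) ^ 2)) ^ ((1 : ℝ) / 4)

/-- A run of `T` steps of the distributed zero-order projected gradient algorithm. Here `x t i`
is the variable `x^i(t)` of agent `i`, `ζ t i` its random direction, and `ξ t i`, `ξ' t i` the
noises in its two queries at time `t`, for `1 ≤ t ≤ T`. The common initial point is a
(possibly random) point of `Θ`. -/
structure IsAlgorithmRun {d n : ℕ} {Ω : Type*} [MeasurableSpace Ω]
    (f : Fin n → Euc d → ℝ) (W : Matrix (Fin n) (Fin n) ℝ) (Θ : Set (Euc d))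
    (η h : ℕ → ℝ) (T : ℕ)
    (ζ : ℕ → Fin n → Ω → Euc d) (ξ ξ' : ℕ → Fin n → Ω → ℝ)
    (x : ℕ → Fin n → Ω → Euc d) : Prop where
  init_measurable : ∀ i, Measurable (x 1 i)
  init_eq : ∀ i j, x 1 i = x 1 j
  init_mem : ∀ i ω, x 1 i ω ∈ Θ
  step : ∀ t, 1 ≤ t → t < T → ∀ i ω,
    x (t + 1) i ω = ∑ k, W i k • euclProj Θ
      (x t k ω - η t • gradEstimator (f k) (h t) (x t k ω) (ζ t k ω) (ξ t k ω) (ξ' t k ω))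

/-- The randomness of the algorithm: the directions are i.i.d. uniform on the unit sphere; the
direction `ζ t i` is independent of the noises `ξ t i`, `ξ' t i` of the agent together with the
current iterates `x t j`, `j = 1, …, n` (which generate the σ-algebra `F_t`); and the second
moments of the noises are at most `σ²`. The noises may be biased and dependent on each other. -/
structure NoiseAssumption {d n : ℕ} {Ω : Type*} [MeasurableSpace Ω] (μ : Measure Ω)
    (σ : ℝ) (T : ℕ)
    (ζ : ℕ → Fin n → Ω → Euc d) (ξ ξ' : ℕ → Fin n → Ω → ℝ)
    (x : ℕ → Fin n → Ω → Euc d) : Prop where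
  dir_measurable : ∀ t, 1 ≤ t → t ≤ T → ∀ i, Measurable (ζ t i)
  dir_law : ∀ t, 1 ≤ t → t ≤ T → ∀ i, μ.map (ζ t i) = uniformUnitSphere d
  dir_iIndep : iIndepFun (fun p : Set.Icc 1 T × Fin n => ζ p.1 p.2) μ
  noise_measurable : ∀ t, 1 ≤ t → t ≤ T → ∀ i, Measurable (ξ t i) ∧ Measurable (ξ' t i)
  indep : ∀ t, 1 ≤ t → t ≤ T → ∀ i,
    IndepFun (ζ t i) (fun ω => ((fun j => x t j ω : Fin n → Euc d), ξ t i ω, ξ' t i ω)) μ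
  noise_memLp : ∀ t, 1 ≤ t → t ≤ T → ∀ i, MemLp (ξ t i) 2 μ ∧ MemLp (ξ' t i) 2 μ
  noise_sq_le : ∀ t, 1 ≤ t → t ≤ T → ∀ i,
    ∫ ω, (ξ t i ω) ^ 2 ∂μ ≤ σ ^ 2 ∧ ∫ ω, (ξ' t i ω) ^ 2 ∂μ ≤ σ ^ 2

/-- The network average `x̄(t) = n⁻¹ ∑ i, x^i(t)`. -/
noncomputable def networkAverage {d n : ℕ} {Ω : Type*} (x : ℕ → Fin n → Ω → Euc d)
    (t : ℕ) (ω : Ω) : Euc d :=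
  (1 / (n : ℝ)) • ∑ i, x t i ω

/-- The tail average `(T - m)⁻¹ ∑_{t = m + 1}^{T} x̄(t)`. -/
noncomputable def tailAverage {d n : ℕ} {Ω : Type*} (x : ℕ → Fin n → Ω → Euc d)
    (m T : ℕ) (ω : Ω) : Euc d :=
  (1 / ((T : ℝ) - (m : ℝ))) • ∑ t ∈ Finset.Icc (m + 1) T, networkAverage x t ω

/-!
The argument tracks three expected quantities of the network at time `t`: the mean square distance
`D t` of the agents to the minimizer `x*`, the consensus error `u t` (the root mean square distance
of the agents to their average `x̄ t`), and the optimality gap of `x̄ t`.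

*The estimator.* The noises drop out of the mean of the two-point estimator, because the direction
is centered and independent of them (`integral_inner_gradEstimator`). What remains is the spherical
derivative `d / (2 h) E (F (x + h z) - F (x - h z)) ⟪z, v⟫`. The divergence theorem makes it an
average of directional derivatives of `F` over a ball of radius `h`; the form needed here is
`le_spherical_derivative`: pointwise lower bounds on the directional derivatives pass to the
spherical derivative, with no loss depending on the dimension. It is derived from the rotation
invariance of the uniform distribution on the sphere, whose infinitesimal form
(`integral_fderiv_rotation_eq_zero`) is an integration by parts on the sphere. For a strongly convex
function it yields the strong convexity inequality up to `L h ^ 2`, of second order in `h`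
(`IsStronglyConvex.le_sphericalDeriv`). The local functions need not be convex, so their spherical
derivatives are first moved to the common point `x̄ t`, at a cost linear in the consensus error
(`le_mean_sphericalDeriv`).

*The recursions.* With `η = 1 / (α t)` a projected step gives
`D (t + 1) ≤ D t - 2 η (gap + α / 2 ‖x̄ - x*‖ ^ 2 - O(h ^ 2 + u)) + η ^ 2 E ‖g‖ ^ 2`, since
mixing does not increase mean square distances; and since `W - n⁻¹ 𝟏 𝟏ᵀ` kills constants,
`u (t + 1) ≤ ρ (u t + η (1 + E ‖g‖ ^ 2))`. For the prescribed `h` both `h ^ 2` and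
`η (1 + E ‖g‖ ^ 2)` are of the order of the rate `d / √(α t) + d ^ 2 / (α t)`.

*The summation.* Both recursions are summed with the weights `min t M`, `M = max m 1`. For `t ≤ m`
the quadratic growth `gap ≥ α / 2 ‖x̄ - x*‖ ^ 2` doubles the contraction of `D`, which pays for the
linear growth of the weights; for `t > m` the weights are constant and the gaps are collected.
The weights suppress the early terms, whose unweighted sum would cost a logarithm, and a weighted
sum of the consensus errors is at most `(1 - ρ)⁻¹` times that of the rates plus `M K`. The latter
is harmless because `α ≤ 2 L`, so that `1 / T` is at most `2 L d ^ 2 / (α T)`. Jensen's inequality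
passes from the mean of the gaps to the gap of the tail average.
-/

/-! ### The uniform distribution on the sphere -/

instance isProbabilityMeasure_uniformUnitSphere (d : ℕ) [NeZero d] :
    IsProbabilityMeasure (uniformUnitSphere d) := by
  have : Nontrivial (Euc d) := by
    have : Nonempty (Fin d) := ⟨0⟩
    infer_instance
  constructor
  rw [uniformUnitSphere, Measure.map_apply measurable_subtype_coe MeasurableSet.univ,
    Set.preimage_univ, Measure.smul_apply, smul_eq_mul]
  refine ENNReal.inv_mul_cancel ?_ (measure_ne_top _ _)
  rw [Ne, Measure.measure_univ_eq_zero]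
  exact Measure.toSphere_ne_zero _

theorem ae_norm_eq_one_uniformUnitSphere (d : ℕ) :
    ∀ᵐ z ∂(uniformUnitSphere d), ‖z‖ = 1 := by
  rw [uniformUnitSphere, ae_map_iff measurable_subtype_coe.aemeasurable
    (measurableSet_eq_fun measurable_norm measurable_const)]
  exact Filter.Eventually.of_forall fun z => by simp

open scoped Pointwise in
theorem uniformUnitSphere_apply {d : ℕ} {s : Set (Euc d)} (hs : MeasurableSet s) :
    uniformUnitSphere d s = (((volume : Measure (Euc d)).toSphere Set.univ)⁻¹ *
      (Module.finrank ℝ (Euc d) *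
        volume (Set.Ioo (0 : ℝ) 1 • (s ∩ Metric.sphere (0 : Euc d) 1)))) := by
  rw [uniformUnitSphere, Measure.map_apply measurable_subtype_coe hs, Measure.smul_apply,
    smul_eq_mul, Measure.toSphere_apply' _ (measurable_subtype_coe hs),
    Subtype.image_preimage_coe, Set.inter_comm]

open scoped Pointwise in
/-- The uniform distribution on the sphere is invariant under linear isometries, because
Lebesgue measure is. -/
theorem map_uniformUnitSphere {d : ℕ} (A : Euc d ≃ₗᵢ[ℝ] Euc d) :
    (uniformUnitSphere d).map A = uniformUnitSphere d := by
  ext s hs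
  have hA : Measurable A := A.continuous.measurable
  rw [Measure.map_apply hA hs, uniformUnitSphere_apply (hA hs), uniformUnitSphere_apply hs]
  congr 2
  have hset : Set.Ioo (0 : ℝ) 1 • (A ⁻¹' s ∩ Metric.sphere (0 : Euc d) 1)
      = A ⁻¹' (Set.Ioo (0 : ℝ) 1 • (s ∩ Metric.sphere (0 : Euc d) 1)) := by
    ext y
    simp only [Set.mem_smul, Set.mem_inter_iff, Set.mem_preimage, mem_sphere_zero_iff_norm]
    constructor
    · rintro ⟨r, hr, z, ⟨hz, hz1⟩, rfl⟩
      exact ⟨r, hr, A z, ⟨hz, by simpa using hz1⟩, by simp⟩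
    · rintro ⟨r, hr, z, ⟨hz, hz1⟩, hy⟩
      refine ⟨r, hr, A.symm z, ⟨by simpa using hz, by simpa using hz1⟩, ?_⟩
      rw [← map_smul, hy, A.symm_apply_apply]
  rw [hset]
  exact (A.measurePreserving).measure_preimage_equiv (f := A.toMeasurableEquiv) _

theorem integral_comp_isometry_uniformUnitSphere {d : ℕ} (A : Euc d ≃ₗᵢ[ℝ] Euc d)
    {F : Euc d → ℝ} (hF : Continuous F) :
    ∫ z, F (A z) ∂(uniformUnitSphere d) = ∫ z, F z ∂(uniformUnitSphere d) := by
  conv_rhs => rw [← map_uniformUnitSphere A]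
  rw [integral_map A.continuous.measurable.aemeasurable hF.aestronglyMeasurable]

theorem integrable_uniformUnitSphere {d : ℕ} [NeZero d] {F : Euc d → ℝ} (hF : Continuous F) :
    Integrable F (uniformUnitSphere d) := by
  obtain ⟨C, hC⟩ := (isCompact_sphere (0 : Euc d) 1).exists_bound_of_continuousOn hF.continuousOn
  refine Integrable.of_bound hF.aestronglyMeasurable C ?_
  filter_upwards [ae_norm_eq_one_uniformUnitSphere d] with z hz
  exact hC z (by simpa using hz)

theorem integral_odd_uniformUnitSphere {d : ℕ} {F : Euc d → ℝ} (hF : Continuous F)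
    (hodd : ∀ z, F (-z) = -F z) : ∫ z, F z ∂(uniformUnitSphere d) = 0 := by
  have h := integral_comp_isometry_uniformUnitSphere (LinearIsometryEquiv.neg ℝ) hF
  simp only [LinearIsometryEquiv.coe_neg, hodd, integral_neg] at h
  linarith

/-- Differentiation under the integral over the sphere. -/
theorem hasDerivAt_integral_uniformUnitSphere {d : ℕ} [NeZero d] {Φ Φ' : ℝ → Euc d → ℝ}
    (hΦ : ∀ s, Continuous (Φ s)) (hΦ' : Continuous (Function.uncurry Φ'))
    (hder : ∀ s z, HasDerivAt (fun s => Φ s z) (Φ' s z) s) (s₀ : ℝ) :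
    HasDerivAt (fun s => ∫ z, Φ s z ∂(uniformUnitSphere d))
      (∫ z, Φ' s₀ z ∂(uniformUnitSphere d)) s₀ := by
  obtain ⟨C, hC⟩ := ((isCompact_closedBall s₀ 1).prod
    (isCompact_sphere (0 : Euc d) 1)).exists_bound_of_continuousOn hΦ'.continuousOn
  refine (hasDerivAt_integral_of_dominated_loc_of_deriv_le (bound := fun _ => C)
    (Metric.closedBall_mem_nhds s₀ one_pos)
    (Filter.Eventually.of_forall fun s => (hΦ s).aestronglyMeasurable)
    (integrable_uniformUnitSphere (hΦ s₀))
    (hΦ'.comp (by fun_prop : Continuous fun z => (s₀, z))).aestronglyMeasurable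
    ?_ (integrable_const _) (Filter.Eventually.of_forall fun z s _ => hder s z)).2
  filter_upwards [ae_norm_eq_one_uniformUnitSphere d] with z hz s hs
  exact hC (s, z) ⟨hs, by simpa using hz⟩

/-- The rotation by the angle `s` in the plane spanned by the orthonormal vectors `a`, `b`. -/
noncomputable def planeRotation {d : ℕ} (a b : Euc d) (s : ℝ) : Euc d →ₗ[ℝ] Euc d :=
  LinearMap.id
    + ((Real.cos s - 1) • innerₗ (Euc d) a - Real.sin s • innerₗ (Euc d) b).smulRight a
    + (Real.sin s • innerₗ (Euc d) a + (Real.cos s - 1) • innerₗ (Euc d) b).smulRight b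

theorem planeRotation_apply {d : ℕ} (a b : Euc d) (s : ℝ) (z : Euc d) :
    planeRotation a b s z = z
      + ((Real.cos s - 1) * inner ℝ a z - Real.sin s * inner ℝ b z) • a
      + (Real.sin s * inner ℝ a z + (Real.cos s - 1) * inner ℝ b z) • b := by
  simp [planeRotation]

theorem norm_planeRotation {d : ℕ} {a b : Euc d} (ha : ‖a‖ = 1) (hb : ‖b‖ = 1)
    (hab : inner ℝ a b = 0) (s : ℝ) (z : Euc d) : ‖planeRotation a b s z‖ = ‖z‖ := by
  have hba : inner ℝ b a = 0 := by rw [real_inner_comm]; exact hab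
  have hsq : ‖planeRotation a b s z‖ ^ 2 = ‖z‖ ^ 2 := by
    rw [planeRotation_apply]
    set p := (Real.cos s - 1) * inner ℝ a z - Real.sin s * inner ℝ b z with hp
    set q := Real.sin s * inner ℝ a z + (Real.cos s - 1) * inner ℝ b z with hq
    rw [← real_inner_self_eq_norm_sq, ← real_inner_self_eq_norm_sq]
    simp only [inner_add_left, inner_add_right, inner_smul_left, inner_smul_right, hab, hba,
      real_inner_self_eq_norm_sq a, real_inner_self_eq_norm_sq b, ha, hb,
      real_inner_comm a z, real_inner_comm b z]
    simp only [conj_trivial]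
    rw [hp, hq]
    linear_combination ((inner ℝ a z) ^ 2 + (inner ℝ b z) ^ 2) * Real.sin_sq_add_cos_sq s
  nlinarith [norm_nonneg z, norm_nonneg (planeRotation a b s z),
    sq_nonneg (‖planeRotation a b s z‖ - ‖z‖)]

/-- Infinitesimal rotation invariance: the average over the sphere of the derivative of `F` along
the generator of a plane rotation vanishes. -/
theorem integral_fderiv_rotation_eq_zero {d : ℕ} [NeZero d] {a b : Euc d} (ha : ‖a‖ = 1)
    (hb : ‖b‖ = 1) (hab : inner ℝ a b = 0) {F : Euc d → ℝ} (hF : ContDiff ℝ 1 F) :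
    ∫ z, (inner ℝ a z * fderiv ℝ F z b - inner ℝ b z * fderiv ℝ F z a)
      ∂(uniformUnitSphere d) = 0 := by
  have hcurve : ∀ s z, HasDerivAt (fun s => planeRotation a b s z)
      ((-Real.sin s * inner ℝ a z - Real.cos s * inner ℝ b z) • a
        + (Real.cos s * inner ℝ a z + -Real.sin s * inner ℝ b z) • b) s := by
    intro s z
    simp only [planeRotation_apply]
    have h1 := ((Real.hasDerivAt_cos s).sub_const 1).mul_const (inner ℝ a z)
    have h2 := (Real.hasDerivAt_sin s).mul_const (inner ℝ b z)
    have h3 := (Real.hasDerivAt_sin s).mul_const (inner ℝ a z)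
    have h4 := ((Real.hasDerivAt_cos s).sub_const 1).mul_const (inner ℝ b z)
    have := (((h1.sub h2).smul_const a).const_add z).add ((h3.add h4).smul_const b)
    exact this
  have hcont : Continuous fun p : ℝ × Euc d => planeRotation a b p.1 p.2 := by
    simp only [planeRotation_apply]; fun_prop
  have hfd : Continuous (fderiv ℝ F) := hF.continuous_fderiv one_ne_zero
  have hder := hasDerivAt_integral_uniformUnitSphere (d := d)
    (Φ := fun s z => F (planeRotation a b s z))
    (Φ' := fun s z => fderiv ℝ F (planeRotation a b s z)
      ((-Real.sin s * inner ℝ a z - Real.cos s * inner ℝ b z) • a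
        + (Real.cos s * inner ℝ a z + -Real.sin s * inner ℝ b z) • b))
    (fun s => hF.continuous.comp (planeRotation a b s).continuous_of_finiteDimensional)
    (by
      have h1 : Continuous fun p : ℝ × Euc d => fderiv ℝ F (planeRotation a b p.1 p.2) :=
        hfd.comp hcont
      exact h1.clm_apply (by fun_prop))
    (fun s z => ((hF.differentiable one_ne_zero) _).hasFDerivAt.comp_hasDerivAt s (hcurve s z)) 0
  have hconst : (fun s => ∫ z, F (planeRotation a b s z) ∂(uniformUnitSphere d))
      = fun _ => ∫ z, F z ∂(uniformUnitSphere d) := by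
    funext s
    exact integral_comp_isometry_uniformUnitSphere
      (LinearIsometry.toLinearIsometryEquiv
        ⟨planeRotation a b s, norm_planeRotation ha hb hab s⟩ rfl) hF.continuous
  rw [hconst] at hder
  have h0 := hder.unique (hasDerivAt_const _ _)
  rw [← h0]
  refine integral_congr_ae (Filter.Eventually.of_forall fun z => ?_)
  have : planeRotation a b 0 z = z := by simp [planeRotation_apply]
  simp only [this, Real.sin_zero, Real.cos_zero, map_add, map_smul, smul_eq_mul]
  ring

theorem fderiv_mul_coord {d : ℕ} {F : Euc d → ℝ} (hF : ContDiff ℝ 1 F) (j : Fin d)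
    (z v : Euc d) :
    fderiv ℝ (fun y : Euc d => F y * y j) z v = fderiv ℝ F z v * z j + F z * v j := by
  have h1 := ((hF.differentiable one_ne_zero) z).hasFDerivAt
  have h2 : HasFDerivAt (fun y : Euc d => y j) (EuclideanSpace.proj j : Euc d →L[ℝ] ℝ) z :=
    (EuclideanSpace.proj j : Euc d →L[ℝ] ℝ).hasFDerivAt
  have h3 : HasFDerivAt (fun y : Euc d => F y * y j) _ z := h1.mul h2
  rw [h3.fderiv]
  simp
  ring

theorem clm_apply_eq_sum {d : ℕ} (l : Euc d →L[ℝ] ℝ) (v : Euc d) :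
    l v = ∑ i, v i * l (EuclideanSpace.single i 1) := by
  conv_lhs => rw [← (EuclideanSpace.basisFun (Fin d) ℝ).sum_repr v]
  simp [map_sum]

/-- Integration by parts on the sphere in a coordinate direction. -/
theorem integral_mul_coord_uniformUnitSphere {d : ℕ} [NeZero d] {F : Euc d → ℝ}
    (hF : ContDiff ℝ 1 F) (i : Fin d) :
    ((d : ℝ) - 1) * ∫ z, F z * z i ∂(uniformUnitSphere d)
      = ∫ z, (fderiv ℝ F z (EuclideanSpace.single i 1) - z i * fderiv ℝ F z z)
        ∂(uniformUnitSphere d) := by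
  have hfd : Continuous (fderiv ℝ F) := hF.continuous_fderiv one_ne_zero
  have hFc := hF.continuous
  have hco : ∀ j : Fin d, ContDiff ℝ 1 fun y : Euc d => y j := fun j =>
    (EuclideanSpace.proj j : Euc d →L[ℝ] ℝ).contDiff
  have hG : ∀ j : Fin d, ContDiff ℝ 1 fun y : Euc d => F y * y j := fun j => hF.mul (hco j)
  set e : Fin d → Euc d := fun j => EuclideanSpace.single j 1 with he
  have hej : ∀ j, ‖e j‖ = 1 := fun j => by simp [he]
  have hin : ∀ (j : Fin d) (z : Euc d), inner ℝ (e j) z = z j := fun j z => by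
    simp [he, EuclideanSpace.inner_single_left]
  have hterm : ∀ j, ∫ z, (z j * fderiv ℝ (fun y : Euc d => F y * y j) z (e i)
      - z i * fderiv ℝ (fun y : Euc d => F y * y j) z (e j)) ∂(uniformUnitSphere d) = 0 := by
    intro j
    rcases eq_or_ne j i with rfl | hji
    · simp
    · have h := integral_fderiv_rotation_eq_zero (hej j) (hej i)
        (by rw [hin]; simp [he, hji]) (hG j)
      simpa only [hin] using h
  have hsum : ∫ z, ∑ j, (z j * fderiv ℝ (fun y : Euc d => F y * y j) z (e i)
      - z i * fderiv ℝ (fun y : Euc d => F y * y j) z (e j)) ∂(uniformUnitSphere d) = 0 := by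
    rw [integral_finsetSum]
    · exact Finset.sum_eq_zero fun j _ => hterm j
    · intro j _
      apply integrable_uniformUnitSphere
      have := (hG j).continuous_fderiv one_ne_zero
      fun_prop
  have hint : ∀ z : Euc d, ‖z‖ = 1 →
      ∑ j, (z j * fderiv ℝ (fun y : Euc d => F y * y j) z (e i)
        - z i * fderiv ℝ (fun y : Euc d => F y * y j) z (e j))
      = (fderiv ℝ F z (e i) - z i * fderiv ℝ F z z) - ((d : ℝ) - 1) * (F z * z i) := by
    intro z hz
    have hz2 : ∑ j, z j ^ 2 = 1 := by
      rw [← EuclideanSpace.real_norm_sq_eq, hz, one_pow]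
    have hexp : fderiv ℝ F z z = ∑ j, z j * fderiv ℝ F z (e j) := clm_apply_eq_sum _ _
    have hei : ∑ j, z j * (F z * e i j) = z i * F z := by
      simp [he]
    simp only [fderiv_mul_coord hF]
    have : ∀ j, (z j * (fderiv ℝ F z (e i) * z j + F z * e i j)
        - z i * (fderiv ℝ F z (e j) * z j + F z * e j j))
        = z j ^ 2 * fderiv ℝ F z (e i) + z j * (F z * e i j)
          - z i * (z j * fderiv ℝ F z (e j)) - z i * F z := by
      intro j
      have : e j j = 1 := by simp [he]
      rw [this]; ring
    simp only [this, Finset.sum_sub_distrib, Finset.sum_add_distrib, ← Finset.sum_mul,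
      ← Finset.mul_sum, hz2, hei, ← hexp]
    simp
    ring
  have hae : ∫ z, ∑ j, (z j * fderiv ℝ (fun y : Euc d => F y * y j) z (e i)
      - z i * fderiv ℝ (fun y : Euc d => F y * y j) z (e j)) ∂(uniformUnitSphere d)
      = ∫ z, ((fderiv ℝ F z (e i) - z i * fderiv ℝ F z z) - ((d : ℝ) - 1) * (F z * z i))
        ∂(uniformUnitSphere d) := by
    refine integral_congr_ae ?_
    filter_upwards [ae_norm_eq_one_uniformUnitSphere d] with z hz using hint z hz
  rw [hae, integral_sub, integral_const_mul] at hsum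
  · linarith
  · apply integrable_uniformUnitSphere; fun_prop
  · apply integrable_uniformUnitSphere; fun_prop

/-- Integration by parts on the unit sphere, a form of the divergence theorem: the tangential
part of the gradient averages to `d - 1` times the average of `F` against the normal. -/
theorem integral_mul_inner_uniformUnitSphere {d : ℕ} [NeZero d] {F : Euc d → ℝ}
    (hF : ContDiff ℝ 1 F) (v : Euc d) :
    ((d : ℝ) - 1) * ∫ z, F z * inner ℝ z v ∂(uniformUnitSphere d)
      = ∫ z, (fderiv ℝ F z v - inner ℝ z v * fderiv ℝ F z z) ∂(uniformUnitSphere d) := by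
  have hfd : Continuous (fderiv ℝ F) := hF.continuous_fderiv one_ne_zero
  have hFc := hF.continuous
  have hin : ∀ z : Euc d, inner ℝ z v = ∑ i, v i * z i := fun z => by
    simp [PiLp.inner_apply]
  have hv : ∀ z, fderiv ℝ F z v = ∑ i, v i * fderiv ℝ F z (EuclideanSpace.single i 1)  := fun z =>
    clm_apply_eq_sum _ _
  have h1 : ∀ z, F z * inner ℝ z v = ∑ i, v i * (F z * z i) := fun z => by
    rw [hin, Finset.mul_sum]; exact Finset.sum_congr rfl fun i _ => by ring
  have h2 : ∀ z, fderiv ℝ F z v - inner ℝ z v * fderiv ℝ F z z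
      = ∑ i, v i * (fderiv ℝ F z (EuclideanSpace.single i 1) - z i * fderiv ℝ F z z) := fun z => by
    rw [hin, hv, Finset.sum_mul, ← Finset.sum_sub_distrib]
    exact Finset.sum_congr rfl fun i _ => by ring
  simp only [h1, h2]
  rw [integral_finsetSum, integral_finsetSum, Finset.mul_sum]
  · refine Finset.sum_congr rfl fun i _ => ?_
    rw [integral_const_mul, integral_const_mul, ← integral_mul_coord_uniformUnitSphere hF i]
    ring
  · intro i _; apply integrable_uniformUnitSphere; fun_prop
  · intro i _; apply integrable_uniformUnitSphere; fun_prop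

/-- The scalar two-point randomized derivative. If all directional derivatives of `F` along `v`
in the ball of radius `h` are at least `c`, then so is the spherical estimate of the derivative.
With `φ r` the average of `F (r z) ⟪z, v⟫` over the unit sphere, integration by parts says that
`r ^ (d - 1) φ r` has derivative `r ^ (d - 1)` times the average of the directional derivative on
the sphere of radius `r`. -/
theorem le_spherical_derivative {d : ℕ} [NeZero d] {F : Euc d → ℝ} (hF : ContDiff ℝ 1 F)
    {v : Euc d} {c h : ℝ} (hh : 0 < h) (hc : ∀ y, ‖y‖ ≤ h → c ≤ fderiv ℝ F y v) :
    c ≤ (d : ℝ) / h * ∫ z, F (h • z) * inner ℝ z v ∂(uniformUnitSphere d) := by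
  have hfd : Continuous (fderiv ℝ F) := hF.continuous_fderiv one_ne_zero
  have hFc := hF.continuous
  have hdF := hF.differentiable one_ne_zero
  obtain ⟨k, hk⟩ : ∃ k, d = k + 1 := Nat.exists_eq_succ_of_ne_zero (NeZero.ne d)
  have hdk : (d : ℝ) = k + 1 := by rw [hk]; push_cast; rfl
  set φ : ℝ → ℝ := fun r => ∫ z, F (r • z) * inner ℝ z v ∂(uniformUnitSphere d) with hφ
  set φ' : ℝ → ℝ := fun r => ∫ z, fderiv ℝ F (r • z) z * inner ℝ z v ∂(uniformUnitSphere d)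
    with hφ'
  set A : ℝ → ℝ := fun r => ∫ z, fderiv ℝ F (r • z) v ∂(uniformUnitSphere d) with hA
  have hφder : ∀ r, HasDerivAt φ (φ' r) r := by
    intro r
    refine hasDerivAt_integral_uniformUnitSphere (d := d)
      (Φ := fun r z => F (r • z) * inner ℝ z v)
      (Φ' := fun r z => fderiv ℝ F (r • z) z * inner ℝ z v) (fun s => by fun_prop) ?_ ?_ r
    · have : Continuous fun p : ℝ × Euc d => fderiv ℝ F (p.1 • p.2) := hfd.comp (by fun_prop)
      exact (this.clm_apply continuous_snd).mul (by fun_prop)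
    · intro s z
      have h1 : HasDerivAt (fun s : ℝ => s • z) z s := by
        simpa using (hasDerivAt_id s).smul_const z
      exact ((hdF (s • z)).hasFDerivAt.comp_hasDerivAt s h1).mul_const _
  have hparts : ∀ r, (k : ℝ) * φ r = r * (A r - φ' r) := by
    intro r
    have hs : ContDiff ℝ 1 fun y : Euc d => F (r • y) := hF.comp (contDiff_const_smul r)
    have hfs : ∀ z w : Euc d, fderiv ℝ (fun y : Euc d => F (r • y)) z w
        = r * fderiv ℝ F (r • z) w := by
      intro z w
      have h1 : HasFDerivAt (fun y : Euc d => r • y) (r • ContinuousLinearMap.id ℝ (Euc d)) z :=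
        (hasFDerivAt_id z).const_smul r
      have h2 : HasFDerivAt (fun y : Euc d => F (r • y)) _ z :=
        (hdF (r • z)).hasFDerivAt.comp z h1
      rw [h2.fderiv]
      simp
    have h := integral_mul_inner_uniformUnitSphere hs v
    simp only [hfs] at h
    rw [hdk, add_sub_cancel_right] at h
    simp only [hφ, hA, hφ']
    rw [h, ← integral_sub, ← integral_const_mul]
    · exact integral_congr_ae (Filter.Eventually.of_forall fun z => by dsimp only; ring)
    · apply integrable_uniformUnitSphere; fun_prop
    · apply integrable_uniformUnitSphere; fun_prop
  have hφ0 : φ 0 = 0 := by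
    simp only [hφ, zero_smul]
    exact integral_odd_uniformUnitSphere (by fun_prop) fun z => by rw [inner_neg_left]; ring
  have hAc : ∀ r, 0 < r → r < h → c ≤ A r := by
    intro r hr hrh
    have hint : Integrable (fun z => fderiv ℝ F (r • z) v) (uniformUnitSphere d) := by
      apply integrable_uniformUnitSphere; fun_prop
    have : ∫ _z, c ∂(uniformUnitSphere d) ≤ A r := by
      refine integral_mono_ae (integrable_const c) hint ?_
      filter_upwards [ae_norm_eq_one_uniformUnitSphere d] with z hz
      refine hc _ ?_
      rw [norm_smul, hz, mul_one, Real.norm_of_nonneg hr.le]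
      exact hrh.le
    simpa using this
  set χ : ℝ → ℝ := fun r => r ^ k * φ r - c * (r ^ (k + 1) / (k + 1)) with hχ
  have hχder : ∀ r, HasDerivAt χ
      ((k : ℝ) * r ^ (k - 1) * φ r + r ^ k * φ' r - c * r ^ k) r := by
    intro r
    have h1 := (hasDerivAt_pow k r).mul (hφder r)
    have h2 := ((hasDerivAt_pow (k + 1) r).div_const ((k : ℝ) + 1)).const_mul c
    have h3 := h1.sub h2
    refine h3.congr_deriv ?_
    have : (k : ℝ) + 1 ≠ 0 := by positivity
    push_cast
    field_simp
  have hmono : MonotoneOn χ (Set.Icc 0 h) := by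
    refine monotoneOn_of_deriv_nonneg (convex_Icc 0 h)
      (fun r _ => (hχder r).continuousAt.continuousWithinAt)
      (fun r _ => (hχder r).differentiableAt.differentiableWithinAt) ?_
    intro r hr
    rw [interior_Icc] at hr
    rw [(hχder r).deriv]
    have hkey : (k : ℝ) * r ^ (k - 1) * φ r = r ^ k * (A r - φ' r) := by
      rcases Nat.eq_zero_or_pos k with h0 | hpos
      · have := hparts r
        rw [h0, Nat.cast_zero, zero_mul] at this
        rw [h0, Nat.cast_zero, zero_mul, zero_mul, pow_zero, one_mul]
        exact ((mul_eq_zero.mp this.symm).resolve_left hr.1.ne').symm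
      · obtain ⟨j, rfl⟩ : ∃ j, k = j + 1 := Nat.exists_eq_succ_of_ne_zero hpos.ne'
        calc ((j + 1 : ℕ) : ℝ) * r ^ (j + 1 - 1) * φ r
            = r ^ j * (((j + 1 : ℕ) : ℝ) * φ r) := by rw [Nat.add_sub_cancel]; ring
          _ = r ^ (j + 1) * (A r - φ' r) := by rw [hparts r]; ring
    rw [hkey]
    have : 0 ≤ r ^ k * (A r - c) :=
      mul_nonneg (pow_nonneg hr.1.le _) (sub_nonneg.mpr (hAc r hr.1 hr.2))
    linarith
  have hfin : χ 0 ≤ χ h := hmono ⟨le_rfl, hh.le⟩ ⟨hh.le, le_rfl⟩ hh.le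
  simp only [hχ, hφ0, mul_zero, zero_sub] at hfin
  rw [zero_pow (Nat.succ_ne_zero k), zero_div, mul_zero, neg_zero] at hfin
  have hk1 : (0 : ℝ) < k + 1 := by positivity
  have hpk : 0 < h ^ k := pow_pos hh k
  have h1 : c * (h / (k + 1)) ≤ φ h := by
    have : h ^ k * (c * (h / (k + 1))) ≤ h ^ k * φ h := by
      calc h ^ k * (c * (h / (k + 1))) = c * (h ^ (k + 1) / (k + 1)) := by ring
        _ ≤ h ^ k * φ h := by linarith
    exact le_of_mul_le_mul_left this hpk
  change c ≤ (d : ℝ) / h * φ h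
  rw [hdk]
  calc c = ((k : ℝ) + 1) / h * (c * (h / (k + 1))) := by field_simp
    _ ≤ _ := mul_le_mul_of_nonneg_left h1 (by positivity)

/-! ### Smooth and strongly convex functions -/

theorem inner_gradient_eq_fderiv {d : ℕ} (f : Euc d → ℝ) (x v : Euc d) :
    inner ℝ (gradient f x) v = fderiv ℝ f x v := by
  rw [← toDual_gradient]; rfl

theorem IsTwoSmooth.contDiff {d : ℕ} {Lbar : ℝ} {f : Euc d → ℝ} (hf : IsTwoSmooth Lbar f) :
    ContDiff ℝ 1 f := by
  rw [contDiff_one_iff_fderiv]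
  refine ⟨hf.1, ?_⟩
  rw [← toDual_comp_gradient (𝕜 := ℝ)]
  refine (LinearIsometryEquiv.continuous _).comp ?_
  have : LipschitzWith (Real.toNNReal Lbar) (gradient f) := by
    refine LipschitzWith.of_dist_le_mul fun x y => ?_
    rw [dist_eq_norm, dist_eq_norm]
    exact (hf.2 x y).trans (mul_le_mul_of_nonneg_right (Real.le_coe_toNNReal _) (norm_nonneg _))
  exact this.continuous

theorem IsTwoSmooth.abs_fderiv_sub_le {d : ℕ} {Lbar : ℝ} {f : Euc d → ℝ}
    (hf : IsTwoSmooth Lbar f) (x x' v : Euc d) :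
    |fderiv ℝ f x v - fderiv ℝ f x' v| ≤ Lbar * ‖x - x'‖ * ‖v‖ := by
  rw [← inner_gradient_eq_fderiv, ← inner_gradient_eq_fderiv, ← inner_sub_left]
  exact (abs_real_inner_le_norm _ _).trans
    (mul_le_mul_of_nonneg_right (hf.2 x x') (norm_nonneg _))

/-- The central second difference of a function of the Hölder class is quadratically small. -/
theorem IsHolderTwo.add_sub_le {d : ℕ} {L : ℝ} {f : Euc d → ℝ} (hf : IsHolderTwo L f)
    (x y : Euc d) : f (x + y) + f (x - y) ≤ 2 * f x + 2 * L * ‖y‖ ^ 2 := by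
  have h1 := (abs_le.mp (hf.2 x (x + y))).2
  have h2 := (abs_le.mp (hf.2 x (x - y))).2
  rw [add_sub_cancel_left] at h1
  rw [show x - y - x = -y by abel, inner_neg_right, norm_neg] at h2
  linarith

/-- The central first difference of a function of the Hölder class. -/
theorem IsHolderTwo.abs_sub_le {d : ℕ} {L : ℝ} {f : Euc d → ℝ} (hf : IsHolderTwo L f)
    (x y : Euc d) :
    |f (x + y) - f (x - y)| ≤ 2 * ‖gradient f x‖ * ‖y‖ + 2 * L * ‖y‖ ^ 2 := by
  have h1 := abs_le.mp (hf.2 x (x + y))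
  have h2 := abs_le.mp (hf.2 x (x - y))
  have h3 := abs_le.mp (abs_real_inner_le_norm (gradient f x) y)
  rw [add_sub_cancel_left] at h1
  rw [show x - y - x = -y by abel, inner_neg_right, norm_neg] at h2
  rw [abs_le]
  constructor <;> linarith [h1.1, h1.2, h2.1, h2.2, h3.1, h3.2]

theorem IsStronglyConvex.le_add_sub {d : ℕ} {α : ℝ} {f : Euc d → ℝ}
    (hf : IsStronglyConvex α f) (x y : Euc d) :
    2 * f x + α * ‖y‖ ^ 2 ≤ f (x + y) + f (x - y) := by
  have h1 := hf.2 (x + y) x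
  have h2 := hf.2 (x - y) x
  rw [add_sub_cancel_left] at h1
  rw [show x - y - x = -y by abel, inner_neg_right, norm_neg] at h2
  linarith

/-- A minimizer of a strongly convex function over a convex set has quadratic growth. -/
theorem IsStronglyConvex.quadratic_growth {d : ℕ} {α : ℝ} {f : Euc d → ℝ}
    (hf : IsStronglyConvex α f) {Θ : Set (Euc d)} (hΘ : Convex ℝ Θ) {xs x : Euc d}
    (hxs : xs ∈ Θ) (hmin : IsMinOn f Θ xs) (hx : x ∈ Θ) :
    α / 2 * ‖x - xs‖ ^ 2 ≤ f x - f xs := by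
  have h0 : 0 ≤ fderiv ℝ f xs (x - xs) := by
    refine (hmin.localize).hasFDerivWithinAt_nonneg
      ((hf.1 xs).hasFDerivAt.hasFDerivWithinAt) ?_
    exact sub_mem_posTangentConeAt_of_segment_subset (hΘ.segment_subset hxs hx)
  have h1 := hf.2 x xs
  rw [inner_gradient_eq_fderiv] at h1
  linarith

theorem avgObjective_contDiff {d n : ℕ} {f : Fin n → Euc d → ℝ}
    (hf : ∀ i, ContDiff ℝ 1 (f i)) : ContDiff ℝ 1 (avgObjective f) := by
  have : ContDiff ℝ 1 fun x => (1 / (n : ℝ)) * ∑ i, f i x :=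
    contDiff_const.mul (ContDiff.sum fun i _ => hf i)
  exact this

theorem mean_const {n : ℕ} (hn : 1 ≤ n) (c : ℝ) : (1 / (n : ℝ)) * ∑ _i : Fin n, c = c := by
  have : (n : ℝ) ≠ 0 := by positivity
  simp [this]

theorem mean_mono {n : ℕ} {a b : Fin n → ℝ} (h : ∀ i, a i ≤ b i) :
    (1 / (n : ℝ)) * ∑ i, a i ≤ (1 / (n : ℝ)) * ∑ i, b i :=
  mul_le_mul_of_nonneg_left (Finset.sum_le_sum fun i _ => h i) (by positivity)

theorem avgObjective_add_sub_le {d n : ℕ} (hn : 1 ≤ n) {L : ℝ} {f : Fin n → Euc d → ℝ}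
    (hf : ∀ i, IsHolderTwo L (f i)) (x y : Euc d) :
    avgObjective f (x + y) + avgObjective f (x - y)
      ≤ 2 * avgObjective f x + 2 * L * ‖y‖ ^ 2 := by
  have h := mean_mono (fun i => (hf i).add_sub_le x y)
  rw [Finset.sum_add_distrib, Finset.sum_add_distrib, mul_add, mul_add, mean_const hn,
    ← Finset.mul_sum] at h
  unfold avgObjective
  linarith

/-- Strong convexity and the Hölder condition bound the same second difference. -/
theorem strongConvexity_le_two_mul {d n : ℕ} [NeZero d] (hn : 1 ≤ n) {L α : ℝ}
    {f : Fin n → Euc d → ℝ} (hf : ∀ i, IsHolderTwo L (f i))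
    (hconv : IsStronglyConvex α (avgObjective f)) : α ≤ 2 * L := by
  have h1 := avgObjective_add_sub_le hn hf 0 (EuclideanSpace.single 0 1)
  have h2 := hconv.le_add_sub 0 (EuclideanSpace.single 0 1)
  simp only [PiLp.norm_single, norm_one, one_pow, mul_one] at h1 h2
  linarith

/-! ### The spherical two-point derivative -/

/-- The mean of the noiseless two-point gradient estimator at `x`, paired with `v`: the average
over the unit sphere of `d / (2 h) (F (x + h z) - F (x - h z)) ⟪z, v⟫`. -/
noncomputable def sphericalDeriv {d : ℕ} (F : Euc d → ℝ) (h : ℝ) (x v : Euc d) : ℝ :=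
  ∫ z, (d : ℝ) / (2 * h) * (F (x + h • z) - F (x - h • z)) * inner ℝ z v ∂(uniformUnitSphere d)

section

variable {d : ℕ}

theorem integrable_sphericalDeriv [NeZero d] {F : Euc d → ℝ} (hF : Continuous F) (h : ℝ)
    (x v : Euc d) :
    Integrable (fun z => (d : ℝ) / (2 * h) * (F (x + h • z) - F (x - h • z)) * inner ℝ z v)
      (uniformUnitSphere d) :=
  integrable_uniformUnitSphere (by fun_prop)

theorem sphericalDeriv_add [NeZero d] {F : Euc d → ℝ} (hF : Continuous F) (h : ℝ) (x v w : Euc d) :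
    sphericalDeriv F h x (v + w) = sphericalDeriv F h x v + sphericalDeriv F h x w := by
  unfold sphericalDeriv
  rw [← integral_add (integrable_sphericalDeriv hF h x v) (integrable_sphericalDeriv hF h x w)]
  simp only [inner_add_right, mul_add]

theorem sphericalDeriv_avgObjective [NeZero d] {n : ℕ} {f : Fin n → Euc d → ℝ}
    (hf : ∀ i, Continuous (f i)) (h : ℝ) (x v : Euc d) :
    sphericalDeriv (avgObjective f) h x v = (1 / (n : ℝ)) * ∑ i, sphericalDeriv (f i) h x v := by
  unfold sphericalDeriv
  rw [← integral_finsetSum _ fun i _ => integrable_sphericalDeriv (hf i) h x v,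
    ← integral_const_mul]
  refine integral_congr_ae (Filter.Eventually.of_forall fun z => ?_)
  simp only [avgObjective]
  rw [← mul_sub, ← Finset.sum_sub_distrib, ← Finset.sum_mul, ← Finset.mul_sum]
  ring

theorem fderiv_reflect {F : Euc d → ℝ} (hF : ContDiff ℝ 1 F) (x y v : Euc d) :
    fderiv ℝ (fun y => (F (x + y) - F (x - y)) / 2) y v
      = (fderiv ℝ F (x + y) v + fderiv ℝ F (x - y) v) / 2 := by
  have hd := hF.differentiable one_ne_zero
  have h1 : HasFDerivAt (fun y => F (x + y)) _ y :=
    (hd (x + y)).hasFDerivAt.comp y ((hasFDerivAt_id y).const_add x)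
  have h2 : HasFDerivAt (fun y => F (x - y)) _ y :=
    (hd (x - y)).hasFDerivAt.comp y ((hasFDerivAt_id y).const_sub x)
  have h3 := (h1.sub h2).mul_const (2 : ℝ)⁻¹
  have e : (fun y => (F (x + y) - F (x - y)) / 2)
      = fun y => ((fun y => F (x + y)) - fun y => F (x - y)) y * (2 : ℝ)⁻¹ := by
    funext y; simp [div_eq_mul_inv]
  rw [e, h3.fderiv]
  simp
  ring

theorem contDiff_reflect {F : Euc d → ℝ} (hF : ContDiff ℝ 1 F) (x : Euc d) :
    ContDiff ℝ 1 fun y => (F (x + y) - F (x - y)) / 2 :=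
  ((hF.comp (contDiff_const.add contDiff_id)).sub
    (hF.comp (contDiff_const.sub contDiff_id))).div_const 2

theorem le_sphericalDeriv [NeZero d] {F : Euc d → ℝ} (hF : ContDiff ℝ 1 F) {h c : ℝ} (hh : 0 < h)
    {x v : Euc d}
    (hc : ∀ y, ‖y‖ ≤ h → c ≤ (fderiv ℝ F (x + y) v + fderiv ℝ F (x - y) v) / 2) :
    c ≤ sphericalDeriv F h x v := by
  refine (le_spherical_derivative (contDiff_reflect hF x) hh (v := v) fun y hy => ?_).trans_eq ?_
  · rw [fderiv_reflect hF]; exact hc y hy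
  · rw [← integral_const_mul]
    unfold sphericalDeriv
    exact integral_congr_ae (Filter.Eventually.of_forall fun z => by dsimp only; ring)

/-- The spherical derivative is Lipschitz in the base point, with the same constant as the
gradient and hence without dependence on the dimension. -/
theorem IsTwoSmooth.sphericalDeriv_sub_ge [NeZero d] {Lbar : ℝ} {f : Euc d → ℝ}
    (hf : IsTwoSmooth Lbar f) {h : ℝ} (hh : 0 < h) (x x' v : Euc d) :
    -(Lbar * ‖x - x'‖ * ‖v‖) ≤ sphericalDeriv f h x v - sphericalDeriv f h x' v := by
  have hC := hf.contDiff
  have hr := contDiff_reflect hC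
  refine (le_spherical_derivative ((hr x).sub (hr x')) hh (v := v) fun y hy => ?_).trans_eq ?_
  · rw [fderiv_fun_sub ((hr x).differentiable one_ne_zero y)
      ((hr x').differentiable one_ne_zero y), sub_apply,
      fderiv_reflect hC, fderiv_reflect hC]
    have h1 := (abs_le.mp (hf.abs_fderiv_sub_le (x + y) (x' + y) v)).1
    have h2 := (abs_le.mp (hf.abs_fderiv_sub_le (x - y) (x' - y) v)).1
    rw [add_sub_add_right_eq_sub] at h1
    rw [sub_sub_sub_cancel_right] at h2
    linarith
  · rw [← integral_const_mul]
    unfold sphericalDeriv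
    rw [← integral_sub (integrable_sphericalDeriv hC.continuous h x v)
      (integrable_sphericalDeriv hC.continuous h x' v)]
    exact integral_congr_ae (Filter.Eventually.of_forall fun z => by dsimp only; ring)

theorem IsTwoSmooth.sphericalDeriv_ge [NeZero d] {Lbar : ℝ} {f : Euc d → ℝ} (hLbar : 0 ≤ Lbar)
    (hf : IsTwoSmooth Lbar f) {h : ℝ} (hh : 0 < h) (x v : Euc d) :
    -((‖gradient f x‖ + Lbar * h) * ‖v‖) ≤ sphericalDeriv f h x v := by
  refine le_sphericalDeriv hf.contDiff hh fun y hy => ?_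
  have h1 := (abs_le.mp (hf.abs_fderiv_sub_le (x + y) x v)).1
  have h2 := (abs_le.mp (hf.abs_fderiv_sub_le (x - y) x v)).1
  have h3 := (abs_le.mp (abs_real_inner_le_norm (gradient f x) v)).1
  rw [inner_gradient_eq_fderiv] at h3
  rw [add_sub_cancel_left] at h1
  rw [show x - y - x = -y by abel, norm_neg] at h2
  have h4 : Lbar * ‖y‖ * ‖v‖ ≤ Lbar * h * ‖v‖ := by gcongr
  linarith

/-- The spherical derivative of a strongly convex function satisfies the strong convexity
inequality up to the error `L h ^ 2`, of second order in `h`: the inequality holds for the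
derivatives at all shifted points `x ± y`, and shifting by `± y` changes the values of the
function by second differences only. -/
theorem IsStronglyConvex.le_sphericalDeriv [NeZero d] {α L : ℝ} {F : Euc d → ℝ} (hα : 0 ≤ α)
    (hL : 0 ≤ L)
    (hconv : IsStronglyConvex α F) (hF : ContDiff ℝ 1 F)
    (hup : ∀ x y, F (x + y) + F (x - y) ≤ 2 * F x + 2 * L * ‖y‖ ^ 2)
    {h : ℝ} (hh : 0 < h) (x z : Euc d) :
    F x - F z + α / 2 * ‖x - z‖ ^ 2 - L * h ^ 2 ≤ sphericalDeriv F h x (x - z) := by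
  refine _root_.le_sphericalDeriv hF hh fun y hy => ?_
  have h1 := hconv.2 (z + y) (x + y)
  have h2 := hconv.2 (z - y) (x - y)
  have h3 := hconv.le_add_sub x y
  have h4 := hup z y
  rw [inner_gradient_eq_fderiv, add_sub_add_right_eq_sub, ← neg_sub x z, map_neg, norm_neg] at h1
  rw [inner_gradient_eq_fderiv, sub_sub_sub_cancel_right, ← neg_sub x z, map_neg, norm_neg] at h2
  have h5 : 0 ≤ α * ‖y‖ ^ 2 := by positivity
  have h6 : L * ‖y‖ ^ 2 ≤ L * h ^ 2 := by gcongr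
  linarith

/-! ### Euclidean projection -/

variable {Θ : Set (Euc d)}

theorem inner_sub_euclProj_le_zero (hc : IsCompact Θ) (hconv : Convex ℝ Θ) (v : Euc d)
    {z : Euc d} (hz : z ∈ Θ) : inner ℝ (v - euclProj Θ v) (z - euclProj Θ v) ≤ 0 := by
  obtain ⟨hp, hmin⟩ := euclProj_spec hc ⟨z, hz⟩ v
  refine (norm_eq_iInf_iff_real_inner_le_zero hconv hp).mp ?_ z hz
  have : Nonempty Θ := ⟨⟨z, hz⟩⟩
  refine le_antisymm (le_ciInf fun w => ?_) (ciInf_le ⟨0, ?_⟩ (⟨_, hp⟩ : Θ))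
  · rw [norm_sub_rev, norm_sub_rev v]; exact hmin w w.2
  · rintro _ ⟨w, rfl⟩; exact norm_nonneg _

theorem norm_euclProj_sub_le (hc : IsCompact Θ) (hne : Θ.Nonempty) (hconv : Convex ℝ Θ)
    (v w : Euc d) : ‖euclProj Θ v - euclProj Θ w‖ ≤ ‖v - w‖ := by
  set p := euclProj Θ v
  set q := euclProj Θ w
  have h1 := inner_sub_euclProj_le_zero hc hconv v (euclProj_spec hc hne w).1
  have h2 := inner_sub_euclProj_le_zero hc hconv w (euclProj_spec hc hne v).1
  have h3 : ‖p - q‖ ^ 2 ≤ inner ℝ (v - w) (p - q) := by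
    have e1 : inner ℝ (v - p) (q - p) = -inner ℝ (v - p) (p - q) := by
      rw [← inner_neg_right, neg_sub]
    have e2 : inner ℝ (v - w) (p - q) = inner ℝ (v - p) (p - q) + inner ℝ (p - q) (p - q)
        - inner ℝ (w - q) (p - q) := by
      rw [← inner_add_left, ← inner_sub_left]; congr 1; abel
    rw [e2, real_inner_self_eq_norm_sq]
    linarith
  have h4 := h3.trans (real_inner_le_norm _ _)
  rcases (norm_nonneg (p - q)).eq_or_lt with h0 | h0
  · rw [← h0]; exact norm_nonneg _
  · nlinarith

theorem continuous_euclProj (hc : IsCompact Θ) (hne : Θ.Nonempty) (hconv : Convex ℝ Θ) :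
    Continuous (euclProj Θ) := by
  have : LipschitzWith 1 (euclProj Θ) := LipschitzWith.of_dist_le_mul fun v w => by
    rw [dist_eq_norm, dist_eq_norm, NNReal.coe_one, one_mul]
    exact norm_euclProj_sub_le hc hne hconv v w
  exact this.continuous

theorem euclProj_of_mem (hc : IsCompact Θ) {z : Euc d} (hz : z ∈ Θ) : euclProj Θ z = z := by
  have := (euclProj_spec hc ⟨z, hz⟩ z).2 z hz
  rw [sub_self, norm_zero, norm_le_zero_iff, sub_eq_zero] at this
  exact this

theorem norm_euclProj_sub_le_of_mem (hc : IsCompact Θ) (hconv : Convex ℝ Θ) (v : Euc d)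
    {z : Euc d} (hz : z ∈ Θ) : ‖euclProj Θ v - z‖ ≤ ‖v - z‖ := by
  conv_lhs => rw [← euclProj_of_mem hc hz]
  exact norm_euclProj_sub_le hc ⟨z, hz⟩ hconv v z

end

/-! ### Consensus of the agents -/

section

variable {d n : ℕ}

/-- The mean of a configuration of `n` points. -/
noncomputable def configMean (X : Fin n → Euc d) : Euc d := (1 / (n : ℝ)) • ∑ i, X i

/-- The root mean square distance of a configuration of points to its mean. -/
noncomputable def consensusError (X : Fin n → Euc d) : ℝ :=
  √((1 / (n : ℝ)) * ∑ i, ‖X i - configMean X‖ ^ 2)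

theorem consensusError_nonneg (X : Fin n → Euc d) : 0 ≤ consensusError X := Real.sqrt_nonneg _

theorem consensusError_sq (X : Fin n → Euc d) :
    consensusError X ^ 2 = (1 / (n : ℝ)) * ∑ i, ‖X i - configMean X‖ ^ 2 :=
  Real.sq_sqrt (by positivity)

theorem configMean_const (hn : 1 ≤ n) (p : Euc d) : configMean (fun _ : Fin n => p) = p := by
  have : (n : ℝ) ≠ 0 := by positivity
  rw [configMean, Finset.sum_const, Finset.card_univ, Fintype.card_fin, ← Nat.cast_smul_eq_nsmul ℝ,
    smul_smul, one_div, inv_mul_cancel₀ this, one_smul]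

theorem consensusError_const (hn : 1 ≤ n) (p : Euc d) :
    consensusError (fun _ : Fin n => p) = 0 := by
  simp [consensusError, configMean_const hn]

theorem sum_sub_configMean (hn : 1 ≤ n) (X : Fin n → Euc d) :
    ∑ i, (X i - configMean X) = 0 := by
  have : (n : ℝ) ≠ 0 := by positivity
  rw [Finset.sum_sub_distrib, Finset.sum_const, Finset.card_univ, Fintype.card_fin, configMean,
    ← Nat.cast_smul_eq_nsmul ℝ, smul_smul, one_div, mul_inv_cancel₀ this, one_smul, sub_self]

theorem mean_norm_le_consensusError (hn : 1 ≤ n) (X : Fin n → Euc d) :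
    (1 / (n : ℝ)) * ∑ i, ‖X i - configMean X‖ ≤ consensusError X := by
  refine Real.le_sqrt_of_sq_le ?_
  have h := sq_sum_le_card_mul_sum_sq (s := Finset.univ) (f := fun i => ‖X i - configMean X‖)
  rw [Finset.card_univ, Fintype.card_fin] at h
  have hn' : (0 : ℝ) < n := by positivity
  calc ((1 / (n : ℝ)) * ∑ i, ‖X i - configMean X‖) ^ 2
      = (1 / (n : ℝ)) ^ 2 * (∑ i, ‖X i - configMean X‖) ^ 2 := by ring
    _ ≤ (1 / (n : ℝ)) ^ 2 * (n * ∑ i, ‖X i - configMean X‖ ^ 2) := by gcongr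
    _ = _ := by field_simp

theorem mean_norm_sub_sq (hn : 1 ≤ n) (X : Fin n → Euc d) (z : Euc d) :
    (1 / (n : ℝ)) * ∑ i, ‖X i - z‖ ^ 2 = ‖configMean X - z‖ ^ 2 + consensusError X ^ 2 := by
  have h : ∀ i, ‖X i - z‖ ^ 2 = ‖X i - configMean X‖ ^ 2
      + 2 * inner ℝ (X i - configMean X) (configMean X - z) + ‖configMean X - z‖ ^ 2 := by
    intro i
    rw [← norm_add_sq_real]
    congr 2; abel
  simp only [h, Finset.sum_add_distrib, mul_add, ← Finset.mul_sum, ← sum_inner]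
  rw [sum_sub_configMean hn, mean_const hn, consensusError_sq, inner_zero_left]
  ring

theorem configMean_mem {Θ : Set (Euc d)} (hΘ : Convex ℝ Θ) (hn : 1 ≤ n) {X : Fin n → Euc d}
    (hX : ∀ i, X i ∈ Θ) : configMean X ∈ Θ := by
  have : (n : ℝ) ≠ 0 := by positivity
  rw [configMean, Finset.smul_sum]
  exact hΘ.sum_mem (fun _ _ => by positivity) (by simp [this]) fun i _ => hX i

theorem norm_sub_le_of_diam {Θ : Set (Euc d)} (hc : IsCompact Θ) {K : ℝ}
    (hK : Metric.diam Θ ≤ K) {x y : Euc d} (hx : x ∈ Θ) (hy : y ∈ Θ) : ‖x - y‖ ≤ K := by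
  rw [← dist_eq_norm]
  exact (Metric.dist_le_diam_of_mem hc.isBounded hx hy).trans hK

theorem consensusError_le {Θ : Set (Euc d)} (hΘ : Convex ℝ Θ) (hc : IsCompact Θ) {K : ℝ}
    (hK : Metric.diam Θ ≤ K) (hn : 1 ≤ n) {X : Fin n → Euc d} (hX : ∀ i, X i ∈ Θ) :
    consensusError X ≤ K := by
  have hm := configMean_mem hΘ hn hX
  have hK0 : 0 ≤ K := Metric.diam_nonneg.trans hK
  refine Real.sqrt_le_iff.mpr ⟨hK0, ?_⟩
  rw [← mean_const hn (K ^ 2)]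
  exact mean_mono fun i =>
    pow_le_pow_left₀ (norm_nonneg _) (norm_sub_le_of_diam hc hK (hX i) hm) 2

/-- A matrix acts on configurations of points with the operator norm that it has on `ℝ^n`. -/
theorem sum_norm_sum_smul_sq_le (A : Matrix (Fin n) (Fin n) ℝ) (z : Fin n → Euc d) :
    ∑ i, ‖∑ k, A i k • z k‖ ^ 2 ≤ spectralNorm2 A ^ 2 * ∑ k, ‖z k‖ ^ 2 := by
  simp only [EuclideanSpace.real_norm_sq_eq]
  rw [Finset.sum_comm, Finset.sum_comm (f := fun k c => (z k) c ^ 2), Finset.mul_sum]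
  refine Finset.sum_le_sum fun c _ => ?_
  set u : EuclideanSpace ℝ (Fin n) := WithLp.toLp 2 fun k => z k c with hu
  have h := (Matrix.toEuclideanCLM (n := Fin n) (𝕜 := ℝ) A).le_opNorm u
  have h2 := pow_le_pow_left₀ (norm_nonneg _) h 2
  rw [mul_pow, EuclideanSpace.real_norm_sq_eq, EuclideanSpace.real_norm_sq_eq] at h2
  refine (le_of_eq ?_).trans h2
  refine Finset.sum_congr rfl fun i _ => ?_
  congr 1
  simp [hu, Matrix.mulVec, dotProduct]

theorem sqrt_sum_norm_add_sq_le (a b : Fin n → Euc d) :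
    √(∑ k, ‖a k + b k‖ ^ 2) ≤ √(∑ k, ‖a k‖ ^ 2) + √(∑ k, ‖b k‖ ^ 2) := by
  have h := norm_add_le (WithLp.toLp 2 a : PiLp 2 fun _ : Fin n => Euc d) (WithLp.toLp 2 b)
  simpa [PiLp.norm_eq_of_L2] using h

theorem networkRho_nonneg (W : Matrix (Fin n) (Fin n) ℝ) : 0 ≤ networkRho W := norm_nonneg _

/-- One step of mixing contracts the consensus error by the factor `ρ`: the matrix
`W - n⁻¹ 𝟏 𝟏ᵀ` annihilates constant configurations. -/
theorem consensusError_mix_le (hn : 1 ≤ n) {W : Matrix (Fin n) (Fin n) ℝ}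
    (hW : W ∈ doublyStochastic ℝ (Fin n)) (X Y : Fin n → Euc d) :
    consensusError (fun i => ∑ k, W i k • Y k)
      ≤ networkRho W * (consensusError X + √((1 / (n : ℝ)) * ∑ k, ‖Y k - X k‖ ^ 2)) := by
  have hn0 : (n : ℝ) ≠ 0 := by positivity
  set A : Matrix (Fin n) (Fin n) ℝ := W - Matrix.of fun _ _ => 1 / (n : ℝ) with hA
  have hrow : ∀ i, ∑ k, W i k = 1 := fun i => sum_row_of_mem_doublyStochastic hW i
  have hcol : ∀ k, ∑ i, W i k = 1 := fun k => sum_col_of_mem_doublyStochastic hW k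
  have hmean : configMean (fun i => ∑ k, W i k • Y k) = configMean Y := by
    unfold configMean
    rw [Finset.sum_comm]
    simp only [← Finset.sum_smul, hcol, one_smul]
  have hArow : ∀ i, ∑ k, A i k = 0 := fun i => by
    simp [hA, hrow, hn0]
  have hkey : ∀ i, ∑ k, W i k • Y k - configMean Y
      = ∑ k, A i k • ((X k - configMean X) + (Y k - X k)) := by
    intro i
    have h1 : ∑ k, A i k • ((X k - configMean X) + (Y k - X k)) = ∑ k, A i k • Y k := by
      have : ∀ k, A i k • ((X k - configMean X) + (Y k - X k))
          = A i k • Y k - A i k • configMean X := fun k => by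
        rw [← smul_sub]; congr 1; abel
      simp only [this, Finset.sum_sub_distrib, ← Finset.sum_smul, hArow, zero_smul, sub_zero]
    rw [h1, configMean, Finset.smul_sum, ← Finset.sum_sub_distrib]
    exact Finset.sum_congr rfl fun k _ => by rw [← sub_smul]; rfl
  have hpos : (0 : ℝ) ≤ 1 / (n : ℝ) := by positivity
  unfold consensusError
  rw [hmean]
  simp only [hkey]
  rw [Real.sqrt_mul hpos, Real.sqrt_mul hpos, Real.sqrt_mul hpos, ← mul_add]
  have h1 : √(∑ i, ‖∑ k, A i k • ((X k - configMean X) + (Y k - X k))‖ ^ 2)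
      ≤ networkRho W * √(∑ k, ‖(X k - configMean X) + (Y k - X k)‖ ^ 2) := by
    refine Real.sqrt_le_iff.mpr ⟨mul_nonneg (networkRho_nonneg W) (Real.sqrt_nonneg _), ?_⟩
    rw [mul_pow, Real.sq_sqrt (by positivity)]
    exact sum_norm_sum_smul_sq_le A _
  calc √(1 / (n : ℝ)) * √(∑ i, ‖∑ k, A i k • ((X k - configMean X) + (Y k - X k))‖ ^ 2)
      ≤ √(1 / (n : ℝ)) * (networkRho W
          * (√(∑ k, ‖X k - configMean X‖ ^ 2) + √(∑ k, ‖Y k - X k‖ ^ 2))) := by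
        refine mul_le_mul_of_nonneg_left (h1.trans ?_) (Real.sqrt_nonneg _)
        exact mul_le_mul_of_nonneg_left (sqrt_sum_norm_add_sq_le _ _) (networkRho_nonneg W)
    _ = _ := by ring

theorem mean_norm_mix_sub_sq_le {W : Matrix (Fin n) (Fin n) ℝ}
    (hW : W ∈ doublyStochastic ℝ (Fin n)) (Y : Fin n → Euc d) (z : Euc d) :
    (1 / (n : ℝ)) * ∑ i, ‖∑ k, W i k • Y k - z‖ ^ 2 ≤ (1 / (n : ℝ)) * ∑ k, ‖Y k - z‖ ^ 2 := by
  have hrow : ∀ i, ∑ k, W i k = 1 := fun i => sum_row_of_mem_doublyStochastic hW i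
  have hcol : ∀ k, ∑ i, W i k = 1 := fun k => sum_col_of_mem_doublyStochastic hW k
  have h : ∀ i, ‖∑ k, W i k • Y k - z‖ ^ 2 ≤ ∑ k, W i k * ‖Y k - z‖ ^ 2 := by
    intro i
    have hz : ∑ k, W i k • Y k - z = ∑ k, W i k • (Y k - z) := by
      simp only [smul_sub, Finset.sum_sub_distrib, ← Finset.sum_smul, hrow, one_smul]
    have hcv : ConvexOn ℝ Set.univ fun y : Euc d => ‖y‖ ^ 2 :=
      (convexOn_norm convex_univ).pow (fun _ _ => norm_nonneg _) 2
    rw [hz]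
    simpa only [smul_eq_mul] using hcv.map_sum_le (t := Finset.univ) (w := W i)
      (p := fun k => Y k - z) (fun k _ => nonneg_of_mem_doublyStochastic hW) (hrow i)
      (fun _ _ => Set.mem_univ _)
  refine (mean_mono h).trans_eq ?_
  rw [Finset.sum_comm]
  simp only [← Finset.sum_mul, hcol, one_mul]

theorem mix_mem {Θ : Set (Euc d)} (hΘ : Convex ℝ Θ) {W : Matrix (Fin n) (Fin n) ℝ}
    (hW : W ∈ doublyStochastic ℝ (Fin n)) {Y : Fin n → Euc d} (hY : ∀ k, Y k ∈ Θ) (i : Fin n) :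
    ∑ k, W i k • Y k ∈ Θ :=
  hΘ.sum_mem (fun _ _ => nonneg_of_mem_doublyStochastic hW)
    (sum_row_of_mem_doublyStochastic hW i) fun k _ => hY k

/-- The strong convexity inequality of the average objective, for the local spherical derivatives
at the points of a configuration. The local functions need not be convex, so the points are
replaced by their mean, at a cost linear in the consensus error. -/
theorem le_mean_sphericalDeriv [NeZero d] (hn : 1 ≤ n) {L Lbar G K α h : ℝ} (hL : 0 ≤ L)
    (hLbar : 0 ≤ Lbar) (hα : 0 ≤ α) (hh : 0 < h) {f : Fin n → Euc d → ℝ}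
    (hconv : IsStronglyConvex α (avgObjective f)) (hholder : ∀ i, IsHolderTwo L (f i))
    (hsmooth : ∀ i, IsTwoSmooth Lbar (f i)) {Θ : Set (Euc d)} (hΘ : Convex ℝ Θ)
    (hc : IsCompact Θ) (hK : Metric.diam Θ ≤ K) (hG : ∀ i, ∀ x ∈ Θ, ‖gradient (f i) x‖ ≤ G)
    {z : Euc d} (hz : z ∈ Θ) {X : Fin n → Euc d} (hX : ∀ i, X i ∈ Θ) :
    avgObjective f (configMean X) - avgObjective f z + α / 2 * ‖configMean X - z‖ ^ 2 - L * h ^ 2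
        - (G + Lbar * h + Lbar * K) * consensusError X
      ≤ (1 / (n : ℝ)) * ∑ k, sphericalDeriv (f k) h (X k) (X k - z) := by
  have hm := configMean_mem hΘ hn hX
  have hcd : ∀ i, ContDiff ℝ 1 (f i) := fun i => (hsmooth i).contDiff
  have hG0 : 0 ≤ G := (norm_nonneg _).trans (hG ⟨0, by omega⟩ z hz)
  have hK0 : 0 ≤ K := Metric.diam_nonneg.trans hK
  have h1 := hconv.le_sphericalDeriv hα hL (avgObjective_contDiff hcd)
    (avgObjective_add_sub_le hn hholder) hh (configMean X) z
  rw [sphericalDeriv_avgObjective fun i => (hcd i).continuous] at h1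
  have h2 : ∀ k, sphericalDeriv (f k) h (configMean X) (configMean X - z)
      - (G + Lbar * h + Lbar * K) * ‖X k - configMean X‖
      ≤ sphericalDeriv (f k) h (X k) (X k - z) := by
    intro k
    have e1 := (hsmooth k).sphericalDeriv_sub_ge hh (X k) (configMean X) (X k - z)
    have e2 := (hsmooth k).sphericalDeriv_ge hLbar hh (configMean X) (X k - configMean X)
    have e3 := sphericalDeriv_add (hcd k).continuous h (configMean X) (configMean X - z)
      (X k - configMean X)
    rw [show configMean X - z + (X k - configMean X) = X k - z by abel] at e3
    have e4 : Lbar * ‖X k - configMean X‖ * ‖X k - z‖ ≤ Lbar * ‖X k - configMean X‖ * K := by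
      have := norm_sub_le_of_diam hc hK (hX k) hz
      gcongr
    have e5 : (‖gradient (f k) (configMean X)‖ + Lbar * h) * ‖X k - configMean X‖
        ≤ (G + Lbar * h) * ‖X k - configMean X‖ := by
      have := hG k _ hm
      gcongr
    linarith
  have h3 := mean_mono h2
  rw [Finset.sum_sub_distrib, mul_sub, ← Finset.mul_sum, mul_left_comm] at h3
  have h4 : (G + Lbar * h + Lbar * K) * ((1 / (n : ℝ)) * ∑ i, ‖X i - configMean X‖)
      ≤ (G + Lbar * h + Lbar * K) * consensusError X :=
    mul_le_mul_of_nonneg_left (mean_norm_le_consensusError hn X) (by positivity)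
  linarith

end

/-! ### The randomized gradient estimator -/

theorem gradEstimator_norm_sq_le {d : ℕ} {F : Euc d → ℝ} {L G h : ℝ} (hh : 0 < h)
    (hF : IsHolderTwo L F) {x ζ : Euc d} (hG : ‖gradient F x‖ ≤ G) (hζ : ‖ζ‖ = 1) (ξ ξ' : ℝ) :
    ‖gradEstimator F h x ζ ξ ξ'‖ ^ 2
      ≤ 6 * (d : ℝ) ^ 2 * G ^ 2 + 6 * (d : ℝ) ^ 2 * L ^ 2 * h ^ 2
        + 3 * (d : ℝ) ^ 2 / (4 * h ^ 2) * (ξ ^ 2 + ξ' ^ 2) := by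
  have hΔ := hF.abs_sub_le x (h • ζ)
  rw [norm_smul, hζ, mul_one, Real.norm_of_nonneg hh.le] at hΔ
  have hG0 : 0 ≤ G := (norm_nonneg _).trans hG
  have hΔ' : |F (x + h • ζ) - F (x - h • ζ)| ≤ 2 * G * h + 2 * L * h ^ 2 := by
    refine hΔ.trans ?_
    gcongr
  set Δ := F (x + h • ζ) - F (x - h • ζ) with hΔdef
  have hsq : Δ ^ 2 ≤ 8 * G ^ 2 * h ^ 2 + 8 * L ^ 2 * h ^ 4 := by
    rw [← sq_abs]
    refine (pow_le_pow_left₀ (abs_nonneg _) hΔ' 2).trans ?_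
    nlinarith [sq_nonneg (2 * G * h - 2 * L * h ^ 2)]
  have hthree : (Δ + ξ - ξ') ^ 2 ≤ 3 * (Δ ^ 2 + ξ ^ 2 + ξ' ^ 2) := by
    nlinarith [sq_nonneg (Δ - ξ), sq_nonneg (Δ + ξ'), sq_nonneg (ξ + ξ')]
  rw [gradEstimator, norm_smul, hζ, mul_one, Real.norm_eq_abs, sq_abs,
    show F (x + h • ζ) + ξ - (F (x - h • ζ) + ξ') = Δ + ξ - ξ' by rw [hΔdef]; ring, mul_pow]
  calc ((d : ℝ) / (2 * h)) ^ 2 * (Δ + ξ - ξ') ^ 2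
      ≤ ((d : ℝ) / (2 * h)) ^ 2
          * (3 * ((8 * G ^ 2 * h ^ 2 + 8 * L ^ 2 * h ^ 4) + ξ ^ 2 + ξ' ^ 2)) := by
        refine mul_le_mul_of_nonneg_left (hthree.trans ?_) (by positivity)
        linarith
    _ = _ := by field_simp; ring

theorem continuous_gradEstimator {d : ℕ} {F : Euc d → ℝ} (hF : Continuous F) (h : ℝ) :
    Continuous fun p : Euc d × Euc d × ℝ × ℝ =>
      gradEstimator F h p.2.1 p.1 p.2.2.1 p.2.2.2 := by
  unfold gradEstimator
  fun_prop

section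

variable {d : ℕ} {Ω : Type*} [MeasurableSpace Ω] {μ : Measure Ω}

theorem ae_norm_eq_one_of_map {Z : Ω → Euc d} (hZ : Measurable Z)
    (hlaw : μ.map Z = uniformUnitSphere d) : ∀ᵐ ω ∂μ, ‖Z ω‖ = 1 := by
  have h := ae_norm_eq_one_uniformUnitSphere d
  rw [← hlaw] at h
  exact ae_of_ae_map hZ.aemeasurable h

variable [IsProbabilityMeasure μ]

theorem integrable_const_add {φ : Ω → ℝ} (hφ : Integrable φ μ) (c : ℝ) :
    Integrable (fun ω => c + φ ω) μ := (integrable_const c).add hφ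

theorem integral_const_add_of_prob {φ : Ω → ℝ} (hφ : Integrable φ μ) (c : ℝ) :
    ∫ ω, (c + φ ω) ∂μ = c + ∫ ω, φ ω ∂μ := by
  rw [integral_add (integrable_const c) hφ]
  simp

variable {F : Euc d → ℝ} {L G h : ℝ} {Θ : Set (Euc d)}
  {x Z : Ω → Euc d} {ξ ξ' : Ω → ℝ}

theorem measurable_gradEstimator (hF : Continuous F) (h : ℝ) (hx : Measurable x)
    (hZ : Measurable Z) (hξ : Measurable ξ) (hξ' : Measurable ξ') :
    Measurable fun ω => gradEstimator F h (x ω) (Z ω) (ξ ω) (ξ' ω) := by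
  have hFm := hF.measurable
  unfold gradEstimator
  fun_prop

theorem integrable_gradEstimator_norm_sq (hh : 0 < h) (hF : IsHolderTwo L F)
    (hG : ∀ y ∈ Θ, ‖gradient F y‖ ≤ G) (hx : Measurable x) (hxΘ : ∀ ω, x ω ∈ Θ)
    (hZ : Measurable Z) (hlaw : μ.map Z = uniformUnitSphere d) (hξ : Measurable ξ)
    (hξ' : Measurable ξ') (hξ2 : MemLp ξ 2 μ) (hξ2' : MemLp ξ' 2 μ) :
    Integrable (fun ω => ‖gradEstimator F h (x ω) (Z ω) (ξ ω) (ξ' ω)‖ ^ 2) μ := by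
  refine Integrable.mono' (integrable_const_add ((hξ2.integrable_sq.add
    hξ2'.integrable_sq).const_mul (3 * (d : ℝ) ^ 2 / (4 * h ^ 2)))
      (6 * (d : ℝ) ^ 2 * G ^ 2 + 6 * (d : ℝ) ^ 2 * L ^ 2 * h ^ 2))
    ((measurable_gradEstimator hF.1.continuous h hx hZ hξ hξ').norm.pow_const
      2).aestronglyMeasurable ?_
  filter_upwards [ae_norm_eq_one_of_map hZ hlaw] with ω hω
  rw [Real.norm_of_nonneg (by positivity)]
  exact gradEstimator_norm_sq_le hh hF (hG _ (hxΘ ω)) hω _ _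

theorem integral_gradEstimator_norm_sq_le {σ : ℝ} (hh : 0 < h)
    (hF : IsHolderTwo L F)
    (hG : ∀ y ∈ Θ, ‖gradient F y‖ ≤ G) (hx : Measurable x) (hxΘ : ∀ ω, x ω ∈ Θ)
    (hZ : Measurable Z) (hlaw : μ.map Z = uniformUnitSphere d) (hξ : Measurable ξ)
    (hξ' : Measurable ξ') (hξ2 : MemLp ξ 2 μ) (hξ2' : MemLp ξ' 2 μ)
    (hσ : ∫ ω, ξ ω ^ 2 ∂μ ≤ σ ^ 2) (hσ' : ∫ ω, ξ' ω ^ 2 ∂μ ≤ σ ^ 2) :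
    ∫ ω, ‖gradEstimator F h (x ω) (Z ω) (ξ ω) (ξ' ω)‖ ^ 2 ∂μ
      ≤ 6 * (d : ℝ) ^ 2 * G ^ 2 + 6 * (d : ℝ) ^ 2 * L ^ 2 * h ^ 2
        + 3 * (d : ℝ) ^ 2 * σ ^ 2 / (2 * h ^ 2) := by
  have hi := (hξ2.integrable_sq.add hξ2'.integrable_sq).const_mul
    (3 * (d : ℝ) ^ 2 / (4 * h ^ 2))
  have h1 : ∫ ω, ‖gradEstimator F h (x ω) (Z ω) (ξ ω) (ξ' ω)‖ ^ 2 ∂μ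
      ≤ ∫ ω, ((6 * (d : ℝ) ^ 2 * G ^ 2 + 6 * (d : ℝ) ^ 2 * L ^ 2 * h ^ 2)
        + 3 * (d : ℝ) ^ 2 / (4 * h ^ 2) * (ξ ω ^ 2 + ξ' ω ^ 2)) ∂μ := by
    refine integral_mono_ae
      (integrable_gradEstimator_norm_sq hh hF hG hx hxΘ hZ hlaw hξ hξ' hξ2 hξ2')
      (integrable_const_add hi _) ?_
    filter_upwards [ae_norm_eq_one_of_map hZ hlaw] with ω hω
    exact gradEstimator_norm_sq_le hh hF (hG _ (hxΘ ω)) hω _ _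
  refine h1.trans ?_
  have h4 := integral_const_add_of_prob hi
    (6 * (d : ℝ) ^ 2 * G ^ 2 + 6 * (d : ℝ) ^ 2 * L ^ 2 * h ^ 2)
  rw [integral_const_mul, integral_add' hξ2.integrable_sq hξ2'.integrable_sq] at h4
  refine h4.trans_le ?_
  have h2 : 3 * (d : ℝ) ^ 2 / (4 * h ^ 2) * (∫ ω, ξ ω ^ 2 ∂μ + ∫ ω, ξ' ω ^ 2 ∂μ)
      ≤ 3 * (d : ℝ) ^ 2 / (4 * h ^ 2) * (σ ^ 2 + σ ^ 2) := by gcongr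
  have h3 : 3 * (d : ℝ) ^ 2 / (4 * h ^ 2) * (σ ^ 2 + σ ^ 2)
      = 3 * (d : ℝ) ^ 2 * σ ^ 2 / (2 * h ^ 2) := by field_simp; ring
  linarith

theorem integral_inner_gradEstimator_uniformUnitSphere [NeZero d] (hF : Continuous F) (h : ℝ)
    (p v : Euc d) (a b : ℝ) :
    ∫ ζ, inner ℝ (gradEstimator F h p ζ a b) v ∂(uniformUnitSphere d)
      = sphericalDeriv F h p v := by
  have h1 : ∀ ζ, inner ℝ (gradEstimator F h p ζ a b) v
      = (d : ℝ) / (2 * h) * (F (p + h • ζ) - F (p - h • ζ)) * inner ℝ ζ v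
        + (d : ℝ) / (2 * h) * (a - b) * inner ℝ ζ v := fun ζ => by
    rw [gradEstimator, real_inner_smul_left]; ring
  simp only [h1]
  have hc : Continuous fun ζ : Euc d => (d : ℝ) / (2 * h) * (a - b) * inner ℝ ζ v := by fun_prop
  rw [integral_add (integrable_sphericalDeriv hF h p v) (integrable_uniformUnitSphere hc),
    integral_odd_uniformUnitSphere hc fun ζ => by rw [inner_neg_left]; ring, add_zero]
  rfl

/-- The conditional mean of the gradient estimator given the current iterate and the noises,
integrated: the noises drop out, however biased, because the direction is centered and
independent of them. -/
theorem integral_inner_gradEstimator [NeZero d] (hF : Continuous F) (z : Euc d)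
    (hx : Measurable x) (hZ : Measurable Z) (hlaw : μ.map Z = uniformUnitSphere d)
    (hξ : Measurable ξ) (hξ' : Measurable ξ')
    (hind : IndepFun Z (fun ω => (x ω, ξ ω, ξ' ω)) μ)
    (hint : Integrable
      (fun ω => inner ℝ (gradEstimator F h (x ω) (Z ω) (ξ ω) (ξ' ω)) (x ω - z)) μ) :
    Integrable (fun ω => sphericalDeriv F h (x ω) (x ω - z)) μ ∧
    ∫ ω, inner ℝ (gradEstimator F h (x ω) (Z ω) (ξ ω) (ξ' ω)) (x ω - z) ∂μ
      = ∫ ω, sphericalDeriv F h (x ω) (x ω - z) ∂μ := by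
  set U : Ω → Euc d × ℝ × ℝ := fun ω => (x ω, ξ ω, ξ' ω) with hU
  have hUm : Measurable U := hx.prodMk (hξ.prodMk hξ')
  set H : Euc d × Euc d × ℝ × ℝ → ℝ := fun p =>
    inner ℝ (gradEstimator F h p.2.1 p.1 p.2.2.1 p.2.2.2) (p.2.1 - z) with hH
  have hHc : Continuous H := (continuous_gradEstimator hF h).inner (by fun_prop)
  have hZU : Measurable fun ω => (Z ω, U ω) := hZ.prodMk hUm
  have : IsProbabilityMeasure (μ.map U) := Measure.isProbabilityMeasure_map hUm.aemeasurable
  have hmap : μ.map (fun ω => (Z ω, U ω)) = (uniformUnitSphere d).prod (μ.map U) := by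
    rw [← hlaw]
    exact (indepFun_iff_map_prod_eq_prod_map_map hZ.aemeasurable hUm.aemeasurable).mp hind
  have hHint : Integrable H ((uniformUnitSphere d).prod (μ.map U)) := by
    rw [← hmap, integrable_map_measure hHc.aestronglyMeasurable hZU.aemeasurable]
    exact hint
  have hinner : ∀ u : Euc d × ℝ × ℝ, ∫ ζ, H (ζ, u) ∂(uniformUnitSphere d)
      = sphericalDeriv F h u.1 (u.1 - z) := fun u =>
    integral_inner_gradEstimator_uniformUnitSphere hF h u.1 (u.1 - z) u.2.1 u.2.2
  have hsi : Integrable (fun u : Euc d × ℝ × ℝ => sphericalDeriv F h u.1 (u.1 - z))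
      (μ.map U) := by
    have := hHint.integral_prod_right
    simpa only [hinner] using this
  refine ⟨hsi.comp_measurable hUm, ?_⟩
  calc ∫ ω, inner ℝ (gradEstimator F h (x ω) (Z ω) (ξ ω) (ξ' ω)) (x ω - z) ∂μ
      = ∫ p, H p ∂((uniformUnitSphere d).prod (μ.map U)) := by
        rw [← hmap, integral_map hZU.aemeasurable hHc.aestronglyMeasurable]
    _ = ∫ u, sphericalDeriv F h u.1 (u.1 - z) ∂(μ.map U) := by
        rw [integral_prod_symm _ hHint]; simp only [hinner]
    _ = _ := by rw [integral_map hUm.aemeasurable hsi.aestronglyMeasurable]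

end

/-! ### One step of the algorithm in expectation -/

section

variable {d n : ℕ} {Ω : Type*} [MeasurableSpace Ω] {μ : Measure Ω} [IsProbabilityMeasure μ]

theorem continuous_configMean : Continuous (configMean : (Fin n → Euc d) → Euc d) := by
  unfold configMean
  fun_prop

theorem continuous_consensusError : Continuous (consensusError : (Fin n → Euc d) → ℝ) := by
  have := continuous_configMean (d := d) (n := n)
  unfold consensusError
  fun_prop

/-- A continuous function of finitely many random points of a compact set is integrable. -/
theorem integrable_comp_config {Θ : Set (Euc d)} (hc : IsCompact Θ) {X : Fin n → Ω → Euc d}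
    (hX : ∀ i, Measurable (X i)) (hXΘ : ∀ i ω, X i ω ∈ Θ) {Φ : (Fin n → Euc d) → ℝ}
    (hΦ : Continuous Φ) : Integrable (fun ω => Φ fun i => X i ω) μ := by
  obtain ⟨C, hC⟩ := (isCompact_univ_pi fun _ : Fin n => hc).exists_bound_of_continuousOn
    hΦ.continuousOn
  refine Integrable.of_bound (hΦ.measurable.comp (measurable_pi_lambda _ hX)).aestronglyMeasurable
    C (Filter.Eventually.of_forall fun ω => hC _ fun i _ => hXΘ i ω)

/-- The data of one step of the algorithm: the current points of the agents, lying in `Θ`, their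
random directions and their noises. -/
structure IsStepData (μ : Measure Ω) (σ : ℝ) (Θ : Set (Euc d)) (X Z : Fin n → Ω → Euc d)
    (ξ ξ' : Fin n → Ω → ℝ) : Prop where
  point_measurable : ∀ i, Measurable (X i)
  point_mem : ∀ i ω, X i ω ∈ Θ
  dir_measurable : ∀ i, Measurable (Z i)
  dir_law : ∀ i, μ.map (Z i) = uniformUnitSphere d
  noise_measurable : ∀ i, Measurable (ξ i) ∧ Measurable (ξ' i)
  indep : ∀ i, IndepFun (Z i) (fun ω => ((fun j => X j ω : Fin n → Euc d), ξ i ω, ξ' i ω)) μ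
  noise_memLp : ∀ i, MemLp (ξ i) 2 μ ∧ MemLp (ξ' i) 2 μ
  noise_sq_le : ∀ i, ∫ ω, (ξ i ω) ^ 2 ∂μ ≤ σ ^ 2 ∧ ∫ ω, (ξ' i ω) ^ 2 ∂μ ≤ σ ^ 2

variable {σ L Lbar G K α h η : ℝ} {Θ : Set (Euc d)} {X Z : Fin n → Ω → Euc d}
  {ξ ξ' : Fin n → Ω → ℝ} {f : Fin n → Euc d → ℝ}

theorem IsStepData.integrable_norm_sq (D : IsStepData μ σ Θ X Z ξ ξ') (hh : 0 < h)
    (hf : ∀ i, IsHolderTwo L (f i)) (hG : ∀ i, ∀ y ∈ Θ, ‖gradient (f i) y‖ ≤ G) (k : Fin n) :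
    Integrable (fun ω => ‖gradEstimator (f k) h (X k ω) (Z k ω) (ξ k ω) (ξ' k ω)‖ ^ 2) μ :=
  integrable_gradEstimator_norm_sq hh (hf k) (hG k) (D.point_measurable k) (D.point_mem k)
    (D.dir_measurable k) (D.dir_law k) (D.noise_measurable k).1 (D.noise_measurable k).2
    (D.noise_memLp k).1 (D.noise_memLp k).2

/-- The second moment of the gradient estimators. The randomness of the directions is not used, so
the gradient contributes `d ^ 2` in place of `d`, which the rate `d ^ 2 / (α t)` absorbs. -/
theorem IsStepData.integral_mean_norm_sq_le (D : IsStepData μ σ Θ X Z ξ ξ') (hn : 1 ≤ n)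
    (hh : 0 < h)
    (hf : ∀ i, IsHolderTwo L (f i)) (hG : ∀ i, ∀ y ∈ Θ, ‖gradient (f i) y‖ ≤ G) :
    ∫ ω, (1 / (n : ℝ))
        * ∑ k, ‖gradEstimator (f k) h (X k ω) (Z k ω) (ξ k ω) (ξ' k ω)‖ ^ 2 ∂μ
      ≤ 6 * (d : ℝ) ^ 2 * G ^ 2 + 6 * (d : ℝ) ^ 2 * L ^ 2 * h ^ 2
        + 3 * (d : ℝ) ^ 2 * σ ^ 2 / (2 * h ^ 2) := by
  rw [integral_const_mul, integral_finsetSum _ fun k _ => D.integrable_norm_sq hh hf hG k]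
  refine (mean_mono fun k => ?_).trans_eq (mean_const hn _)
  exact integral_gradEstimator_norm_sq_le hh (hf k) (hG k) (D.point_measurable k)
    (D.point_mem k) (D.dir_measurable k) (D.dir_law k) (D.noise_measurable k).1
    (D.noise_measurable k).2 (D.noise_memLp k).1 (D.noise_memLp k).2
    (D.noise_sq_le k).1 (D.noise_sq_le k).2

/-- Decrease of the mean square distance to `z` by a projected step along the estimated
gradients. -/
theorem IsStepData.integral_projected_step_le [NeZero d] (D : IsStepData μ σ Θ X Z ξ ξ')
    (hn : 1 ≤ n) (hL : 0 ≤ L) (hLbar : 0 ≤ Lbar) (hα : 0 ≤ α) (hh : 0 < h) (hη : 0 ≤ η)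
    (hconv : IsStronglyConvex α (avgObjective f)) (hf : ∀ i, IsHolderTwo L (f i))
    (hsmooth : ∀ i, IsTwoSmooth Lbar (f i)) (hΘ : Convex ℝ Θ) (hc : IsCompact Θ)
    (hK : Metric.diam Θ ≤ K) (hG : ∀ i, ∀ x ∈ Θ, ‖gradient (f i) x‖ ≤ G) {z : Euc d}
    (hz : z ∈ Θ) :
    ∫ ω, (1 / (n : ℝ)) * ∑ k, ‖euclProj Θ (X k ω
        - η • gradEstimator (f k) h (X k ω) (Z k ω) (ξ k ω) (ξ' k ω)) - z‖ ^ 2 ∂μ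
      ≤ ∫ ω, (1 / (n : ℝ)) * ∑ k, ‖X k ω - z‖ ^ 2 ∂μ
        - 2 * η * (∫ ω, (avgObjective f (configMean fun k => X k ω) - avgObjective f z) ∂μ
          + α / 2 * ∫ ω, ‖configMean (fun k => X k ω) - z‖ ^ 2 ∂μ - L * h ^ 2
          - (G + Lbar * h + Lbar * K) * ∫ ω, consensusError (fun k => X k ω) ∂μ)
        + η ^ 2 * ∫ ω, (1 / (n : ℝ))
          * ∑ k, ‖gradEstimator (f k) h (X k ω) (Z k ω) (ξ k ω) (ξ' k ω)‖ ^ 2 ∂μ := by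
  have hcd : ∀ i, ContDiff ℝ 1 (f i) := fun i => (hsmooth i).contDiff
  set g : Fin n → Ω → Euc d := fun k ω =>
    gradEstimator (f k) h (X k ω) (Z k ω) (ξ k ω) (ξ' k ω) with hg
  have hgm : ∀ k, Measurable (g k) := fun k =>
    measurable_gradEstimator (hcd k).continuous h (D.point_measurable k) (D.dir_measurable k)
      (D.noise_measurable k).1 (D.noise_measurable k).2
  have hg2 : ∀ k, Integrable (fun ω => ‖g k ω‖ ^ 2) μ := D.integrable_norm_sq hh hf hG
  have hXm := D.point_measurable
  have hcfg := fun {Φ : (Fin n → Euc d) → ℝ} (hΦ : Continuous Φ) =>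
    integrable_comp_config (μ := μ) hc hXm D.point_mem hΦ
  have hcM := continuous_configMean (d := d) (n := n)
  have hcE := continuous_consensusError (d := d) (n := n)
  have hcA : Continuous (avgObjective f) := (avgObjective_contDiff hcd).continuous
  -- The pairing of the estimator with the bounded vector `X k - z` is integrable.
  have hin : ∀ k, Integrable (fun ω => inner ℝ (g k ω) (X k ω - z)) μ := by
    intro k
    have hK0 : 0 ≤ K := Metric.diam_nonneg.trans hK
    refine Integrable.mono' ((integrable_const_add (hg2 k) 1).const_mul K)
      ((hgm k).inner ((hXm k).sub_const z)).aestronglyMeasurable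
      (Filter.Eventually.of_forall fun ω => ?_)
    rw [Real.norm_eq_abs]
    refine (abs_real_inner_le_norm _ _).trans ?_
    rw [mul_comm]
    refine mul_le_mul (norm_sub_le_of_diam hc hK (D.point_mem k ω) hz) ?_ (norm_nonneg _) hK0
    nlinarith [sq_nonneg (‖g k ω‖ - 1), norm_nonneg (g k ω)]
  have hmean := fun k => integral_inner_gradEstimator (h := h) (hcd k).continuous z (hXm k)
    (D.dir_measurable k) (D.dir_law k) (D.noise_measurable k).1 (D.noise_measurable k).2
    ((D.indep k).comp measurable_id
      (((measurable_pi_apply k).comp measurable_fst).prodMk measurable_snd)) (hin k)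
  have hX2 : Integrable (fun ω => (1 / (n : ℝ)) * ∑ k, ‖X k ω - z‖ ^ 2) μ :=
    hcfg (Φ := fun Y => (1 / (n : ℝ)) * ∑ k, ‖Y k - z‖ ^ 2) (by fun_prop)
  have hgap : Integrable
      (fun ω => avgObjective f (configMean fun k => X k ω) - avgObjective f z) μ :=
    hcfg (Φ := fun Y => avgObjective f (configMean Y) - avgObjective f z) (by fun_prop)
  have hdist : Integrable (fun ω => ‖configMean (fun k => X k ω) - z‖ ^ 2) μ :=
    hcfg (Φ := fun Y => ‖configMean Y - z‖ ^ 2) (by fun_prop)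
  have hcons : Integrable (fun ω => consensusError fun k => X k ω) μ := hcfg hcE
  have hI : Integrable (fun ω => (1 / (n : ℝ)) * ∑ k, inner ℝ (g k ω) (X k ω - z)) μ :=
    (integrable_finsetSum _ fun k _ => hin k).const_mul _
  have hS : Integrable (fun ω => (1 / (n : ℝ)) * ∑ k, ‖g k ω‖ ^ 2) μ :=
    (integrable_finsetSum _ fun k _ => hg2 k).const_mul _
  have hlower : ∫ ω, (avgObjective f (configMean fun k => X k ω) - avgObjective f z) ∂μ
      + α / 2 * ∫ ω, ‖configMean (fun k => X k ω) - z‖ ^ 2 ∂μ - L * h ^ 2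
      - (G + Lbar * h + Lbar * K) * ∫ ω, consensusError (fun k => X k ω) ∂μ
      ≤ ∫ ω, (1 / (n : ℝ)) * ∑ k, inner ℝ (g k ω) (X k ω - z) ∂μ := by
    have e1 : ∫ ω, (1 / (n : ℝ)) * ∑ k, inner ℝ (g k ω) (X k ω - z) ∂μ
        = ∫ ω, (1 / (n : ℝ)) * ∑ k, sphericalDeriv (f k) h (X k ω) (X k ω - z) ∂μ := by
      rw [integral_const_mul, integral_const_mul, integral_finsetSum _ fun k _ => hin k,
        integral_finsetSum _ fun k _ => (hmean k).1]
      exact congrArg _ (Finset.sum_congr rfl fun k _ => (hmean k).2)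
    have h1 := hgap.add (hdist.const_mul (α / 2))
    have h2 := h1.sub (integrable_const (L * h ^ 2))
    have h3 := h2.sub (hcons.const_mul (G + Lbar * h + Lbar * K))
    have e2 := integral_mono h3
      ((integrable_finsetSum _ fun k _ => (hmean k).1).const_mul (1 / (n : ℝ)))
      fun ω => le_mean_sphericalDeriv hn hL hLbar hα hh hconv hf hsmooth hΘ hc hK hG hz
        fun i => D.point_mem i ω
    rw [e1]
    refine (le_of_eq ?_).trans e2
    rw [integral_sub' h2 (hcons.const_mul _), integral_sub' h1 (integrable_const _),
      integral_add' hgap (hdist.const_mul _), integral_const_mul (α / 2),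
      integral_const_mul (G + Lbar * h + Lbar * K)]
    simp only [integral_const, probReal_univ, one_smul]
  have hpt : ∀ ω, (1 / (n : ℝ)) * ∑ k, ‖euclProj Θ (X k ω - η • g k ω) - z‖ ^ 2
      ≤ ((1 / (n : ℝ)) * ∑ k, ‖X k ω - z‖ ^ 2
        - 2 * η * ((1 / (n : ℝ)) * ∑ k, inner ℝ (g k ω) (X k ω - z)))
        + η ^ 2 * ((1 / (n : ℝ)) * ∑ k, ‖g k ω‖ ^ 2) := by
    intro ω
    have h1 : ∀ k, ‖euclProj Θ (X k ω - η • g k ω) - z‖ ^ 2 ≤ ‖X k ω - z‖ ^ 2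
        - 2 * η * inner ℝ (g k ω) (X k ω - z) + η ^ 2 * ‖g k ω‖ ^ 2 := by
      intro k
      refine (pow_le_pow_left₀ (norm_nonneg _)
        (norm_euclProj_sub_le_of_mem hc hΘ _ hz) 2).trans_eq ?_
      rw [show X k ω - η • g k ω - z = (X k ω - z) - η • g k ω by abel, norm_sub_sq_real,
        inner_smul_right, norm_smul, mul_pow, Real.norm_eq_abs, sq_abs, real_inner_comm]
      ring
    refine (mean_mono h1).trans_eq ?_
    rw [Finset.sum_add_distrib, Finset.sum_sub_distrib, ← Finset.mul_sum, ← Finset.mul_sum]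
    ring
  have hPm : Continuous (euclProj Θ) := continuous_euclProj hc ⟨z, hz⟩ hΘ
  have hright := (hX2.sub (hI.const_mul (2 * η))).add (hS.const_mul (η ^ 2))
  have hfin := integral_mono_of_nonneg (Filter.Eventually.of_forall fun ω => by
    simp only [Pi.zero_apply]; positivity) hright (Filter.Eventually.of_forall hpt)
  rw [integral_add' (hX2.sub (hI.const_mul (2 * η))) (hS.const_mul (η ^ 2)),
    integral_sub' hX2 (hI.const_mul (2 * η)), integral_const_mul (2 * η),
    integral_const_mul (η ^ 2)] at hfin
  refine hfin.trans ?_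
  have := mul_le_mul_of_nonneg_left hlower (by positivity : 0 ≤ 2 * η)
  linarith

/-- Contraction of the expected consensus error in one step. -/
theorem IsStepData.integral_consensusError_step_le (D : IsStepData μ σ Θ X Z ξ ξ')
    (hn : 1 ≤ n) (hh : 0 < h) (hη : 0 ≤ η) (hf : ∀ i, IsHolderTwo L (f i))
    (hΘ : Convex ℝ Θ) (hc : IsCompact Θ) (hG : ∀ i, ∀ x ∈ Θ, ‖gradient (f i) x‖ ≤ G)
    {W : Matrix (Fin n) (Fin n) ℝ} (hW : W ∈ doublyStochastic ℝ (Fin n)) :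
    ∫ ω, consensusError (fun i => ∑ k, W i k • euclProj Θ (X k ω
        - η • gradEstimator (f k) h (X k ω) (Z k ω) (ξ k ω) (ξ' k ω))) ∂μ
      ≤ networkRho W * (∫ ω, consensusError (fun k => X k ω) ∂μ + η * (1 + ∫ ω, (1 / (n : ℝ))
          * ∑ k, ‖gradEstimator (f k) h (X k ω) (Z k ω) (ξ k ω) (ξ' k ω)‖ ^ 2 ∂μ)) := by
  set g : Fin n → Ω → Euc d := fun k ω =>
    gradEstimator (f k) h (X k ω) (Z k ω) (ξ k ω) (ξ' k ω) with hg
  have hcons : Integrable (fun ω => consensusError fun k => X k ω) μ :=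
    integrable_comp_config hc D.point_measurable D.point_mem continuous_consensusError
  have hS : Integrable (fun ω => (1 / (n : ℝ)) * ∑ k, ‖g k ω‖ ^ 2) μ :=
    (integrable_finsetSum _ fun k _ => D.integrable_norm_sq hh hf hG k).const_mul _
  have hpt : ∀ ω, consensusError (fun i => ∑ k, W i k • euclProj Θ (X k ω - η • g k ω))
      ≤ networkRho W * (consensusError (fun k => X k ω)
        + η * (1 + (1 / (n : ℝ)) * ∑ k, ‖g k ω‖ ^ 2)) := by
    intro ω
    refine (consensusError_mix_le hn hW (fun k => X k ω) _).trans
      (mul_le_mul_of_nonneg_left ?_ (networkRho_nonneg W))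
    refine add_le_add le_rfl (Real.sqrt_le_iff.mpr ⟨by positivity, ?_⟩)
    have h1 : ∀ k, ‖euclProj Θ (X k ω - η • g k ω) - X k ω‖ ^ 2 ≤ η ^ 2 * ‖g k ω‖ ^ 2 := by
      intro k
      refine (pow_le_pow_left₀ (norm_nonneg _)
        (norm_euclProj_sub_le_of_mem hc hΘ _ (D.point_mem k ω)) 2).trans_eq ?_
      rw [sub_sub_cancel_left, norm_neg, norm_smul, mul_pow, Real.norm_eq_abs, sq_abs]
    refine (mean_mono h1).trans ?_
    rw [← Finset.mul_sum, mul_left_comm, mul_pow]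
    refine mul_le_mul_of_nonneg_left ?_ (sq_nonneg η)
    have : 0 ≤ (1 / (n : ℝ)) * ∑ k, ‖g k ω‖ ^ 2 := by positivity
    nlinarith
  have hS1 := (integrable_const_add hS 1).const_mul η
  have hright := (hcons.add hS1).const_mul (networkRho W)
  refine (integral_mono_of_nonneg (Filter.Eventually.of_forall fun ω =>
    consensusError_nonneg _) hright (Filter.Eventually.of_forall hpt)).trans_eq ?_
  rw [integral_const_mul, integral_add' hcons hS1, integral_const_mul,
    integral_const_add_of_prob hS]

end

/-! ### Summation of the recursions -/

/-- Telescoping of a contracting recursion with the weights `min t M`, where `M = max m 1`. Up to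
the time `m` the whole gap is spent on contracting the distance at the rate `1 - 2 / t`, which lets
the weights grow linearly; after it the gaps are collected with the constant weight `M`. -/
theorem sum_gap_le_of_recursion {T m M : ℕ} (hM : M = max m 1) {α : ℝ} (hα : 0 < α)
    {D N gap e : ℕ → ℝ} (hDN : ∀ t, 1 ≤ t → t < T → D (t + 1) ≤ N t)
    (hD : ∀ t, 1 ≤ t → t ≤ T → 0 ≤ D t) (hN : 0 ≤ N T)
    (h1 : ∀ t, 1 ≤ t → t ≤ T → α * t * N t + 2 * gap t ≤ α * (t - 1) * D t + e t)
    (h2 : ∀ t, 1 ≤ t → t ≤ T → α * t * N t ≤ α * (t - 2) * D t + e t) :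
    2 * M * ∑ t ∈ Finset.Icc (m + 1) T, gap t
      ≤ ∑ t ∈ Finset.Icc 1 T, min (t : ℝ) M * e t := by
  have key : ∀ τ, τ ≤ T → α * min (τ : ℝ) M * τ * N τ
      + 2 * M * ∑ t ∈ Finset.Icc (m + 1) τ, gap t
      ≤ ∑ t ∈ Finset.Icc 1 τ, min (t : ℝ) M * e t := by
    intro τ
    induction τ with
    | zero => intro _; simp
    | succ τ ih =>
      intro hτ
      have ih := ih (by omega)
      have hDnn := hD (τ + 1) (by omega) hτ
      have hτ0 : (0 : ℝ) ≤ τ := Nat.cast_nonneg τ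
      have hstep : τ = 0 ∨ D (τ + 1) ≤ N τ := by
        rcases Nat.eq_zero_or_pos τ with h | h
        · exact Or.inl h
        · exact Or.inr (hDN τ h (by omega))
      rw [← Finset.insert_Icc_right_eq_Icc_add_one (by omega : 1 ≤ τ + 1),
        Finset.sum_insert (by simp)]
      rcases Nat.lt_or_ge m (τ + 1) with hm | hm
      · have hMle : (M : ℝ) ≤ (τ + 1 : ℕ) := by
          have : M ≤ τ + 1 := by omega
          exact_mod_cast this
        have hMnn : (0 : ℝ) ≤ M := Nat.cast_nonneg M
        rw [← Finset.insert_Icc_right_eq_Icc_add_one (by omega : m + 1 ≤ τ + 1),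
          Finset.sum_insert (by simp), min_eq_right hMle]
        have h := mul_le_mul_of_nonneg_left (h1 (τ + 1) (by omega) hτ) hMnn
        have hdec : α * M * τ * D (τ + 1) ≤ α * min (τ : ℝ) M * τ * N τ := by
          rcases hstep with h0 | h0
          · simp [h0]
          · rcases Nat.eq_zero_or_pos τ with h | h
            · simp [h]
            · have hMτ : (M : ℝ) ≤ τ := by
                have : M ≤ τ := by omega
                exact_mod_cast this
              rw [min_eq_right hMτ]
              exact mul_le_mul_of_nonneg_left h0 (by positivity)
        push_cast at h ⊢
        linarith
      · have hMm : M = m := by omega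
        have hMge : ((τ + 1 : ℕ) : ℝ) ≤ M := by
          have : τ + 1 ≤ M := by omega
          exact_mod_cast this
        have hτM : (τ : ℝ) ≤ M := by push_cast at hMge; linarith
        rw [min_eq_left hMge, Finset.Icc_eq_empty (by omega)]
        rw [min_eq_left hτM, Finset.Icc_eq_empty (by omega)] at ih
        rw [Finset.sum_empty, mul_zero, add_zero] at ih ⊢
        have h := mul_le_mul_of_nonneg_left (h2 (τ + 1) (by omega) hτ)
          (Nat.cast_nonneg (τ + 1) : (0 : ℝ) ≤ ((τ + 1 : ℕ) : ℝ))
        have hdec : α * τ * τ * D (τ + 1) ≤ α * τ * τ * N τ := by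
          rcases hstep with h0 | h0
          · simp [h0]
          · exact mul_le_mul_of_nonneg_left h0 (by positivity)
        have hαD : 0 ≤ α * D (τ + 1) := mul_nonneg hα.le hDnn
        push_cast at h ⊢
        linarith
  have hT := key T le_rfl
  have : 0 ≤ α * min (T : ℝ) M * T * N T := by positivity
  linarith

/-- Summation of the consensus recursion with the weights `min t M`: the geometric memory costs
the factor `1 / (1 - ρ)`, and the growth of the weights costs `M K`. -/
theorem sum_consensus_le_of_recursion {T M : ℕ} (hT : 1 ≤ T) (hM : 1 ≤ M) {ρ K : ℝ} (hρ : 0 ≤ ρ)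
    (hρ1 : ρ < 1) {u r : ℕ → ℝ} (hu1 : u 1 = 0) (hu : ∀ t, 1 ≤ t → t ≤ T → 0 ≤ u t ∧ u t ≤ K)
    (hr : ∀ t, 1 ≤ t → t ≤ T → 0 ≤ r t)
    (hrec : ∀ t, 1 ≤ t → t < T → u (t + 1) ≤ ρ * (u t + r t)) :
    (1 - ρ) * ∑ t ∈ Finset.Icc 1 T, min (t : ℝ) M * u t
      ≤ M * K + 2 * ∑ t ∈ Finset.Icc 1 T, min (t : ℝ) M * r t := by
  have hK : 0 ≤ K := (hu 1 le_rfl hT).1.trans (hu 1 le_rfl hT).2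
  have key : ∀ τ, τ + 1 ≤ T →
      (1 - ρ) * ∑ t ∈ Finset.Icc 1 (τ + 1), min (t : ℝ) M * u t
        + ρ * (min ((τ + 1 : ℕ) : ℝ) M * u (τ + 1))
      ≤ min ((τ + 1 : ℕ) : ℝ) M * K + 2 * ∑ t ∈ Finset.Icc 1 τ, min (t : ℝ) M * r t := by
    intro τ
    induction τ with
    | zero =>
      intro _
      have hw0 : (0 : ℝ) ≤ min ((0 + 1 : ℕ) : ℝ) M :=
        le_min (Nat.cast_nonneg _) (Nat.cast_nonneg _)
      simpa [hu1] using mul_nonneg hw0 hK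
    | succ τ ih =>
      intro hτ
      have ih := ih (by omega)
      obtain ⟨hu0, huK⟩ := hu (τ + 1) (by omega) (by omega)
      have hr0 := hr (τ + 1) (by omega) (by omega)
      have hre := hrec (τ + 1) (by omega) (by omega)
      rw [← Finset.insert_Icc_right_eq_Icc_add_one (by omega : 1 ≤ τ + 1 + 1),
        Finset.sum_insert (by simp),
        ← Finset.insert_Icc_right_eq_Icc_add_one (by omega : 1 ≤ τ + 1) (b := τ),
        Finset.sum_insert (by simp) (f := fun t : ℕ => min (t : ℝ) M * r t),
        Finset.insert_Icc_right_eq_Icc_add_one (by omega : 1 ≤ τ + 1)]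
      set w := min ((τ + 1 : ℕ) : ℝ) M with hw
      set w' := min ((τ + 1 + 1 : ℕ) : ℝ) M with hw'
      have hMR : (1 : ℝ) ≤ M := by exact_mod_cast hM
      have hτR : (0 : ℝ) ≤ τ := Nat.cast_nonneg τ
      have hww' : w ≤ w' := min_le_min_right _ (by push_cast; linarith)
      have hw2 : w' ≤ 2 * w := by
        rw [hw, hw']
        push_cast
        rcases le_total ((τ : ℝ) + 1) M with h | h
        · rw [min_eq_left h]; exact (min_le_left _ _).trans (by linarith)
        · rw [min_eq_right h]; exact (min_le_right _ _).trans (by linarith)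
      have hw0 : 0 ≤ w := le_min (Nat.cast_nonneg _) (by linarith)
      have e1 := mul_le_mul_of_nonneg_left hre (hw0.trans hww')
      have e2 : ρ * ((w' - w) * u (τ + 1)) ≤ (w' - w) * K :=
        (mul_le_of_le_one_left (mul_nonneg (sub_nonneg.mpr hww') hu0) hρ1.le).trans
          (mul_le_mul_of_nonneg_left huK (sub_nonneg.mpr hww'))
      have e3 : ρ * (w' * r (τ + 1)) ≤ 2 * w * r (τ + 1) :=
        (mul_le_of_le_one_left (mul_nonneg (hw0.trans hww') hr0) hρ1.le).trans
          (mul_le_mul_of_nonneg_right hw2 hr0)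
      linarith
  obtain ⟨τ, rfl⟩ : ∃ τ, T = τ + 1 := ⟨T - 1, by omega⟩
  have h := key τ le_rfl
  have hw0 : (0 : ℝ) ≤ min ((τ + 1 : ℕ) : ℝ) M := le_min (Nat.cast_nonneg _) (Nat.cast_nonneg _)
  have h1 : 0 ≤ ρ * (min ((τ + 1 : ℕ) : ℝ) M * u (τ + 1)) :=
    mul_nonneg hρ (mul_nonneg hw0 (hu (τ + 1) (by omega) le_rfl).1)
  have h2 : min ((τ + 1 : ℕ) : ℝ) M * K ≤ M * K :=
    mul_le_mul_of_nonneg_right (min_le_right _ _) hK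
  have h3 : ∑ t ∈ Finset.Icc 1 τ, min (t : ℝ) M * r t
      ≤ ∑ t ∈ Finset.Icc 1 (τ + 1), min (t : ℝ) M * r t := by
    refine Finset.sum_le_sum_of_subset_of_nonneg
      (Finset.Icc_subset_Icc_right (Nat.le_succ τ)) fun t ht _ => ?_
    rw [Finset.mem_Icc] at ht
    exact mul_nonneg (le_min (Nat.cast_nonneg _) (Nat.cast_nonneg _)) (hr t ht.1 ht.2)
  linarith

theorem sum_weighted_rate_le {T M : ℕ} {α a b : ℝ} (hα : 0 < α) (ha : 0 ≤ a) (hb : 0 ≤ b) :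
    ∑ t ∈ Finset.Icc 1 T, min (t : ℝ) M * (a / √(α * t) + b / (α * t))
      ≤ T * (√M * a / √α + b / α) := by
  have hterm : ∀ t ∈ Finset.Icc 1 T, min (t : ℝ) M * (a / √(α * t) + b / (α * t))
      ≤ √M * a / √α + b / α := by
    intro t ht
    have ht1 : 1 ≤ t := (Finset.mem_Icc.mp ht).1
    have ht0 : (0 : ℝ) < t := by exact_mod_cast ht1
    have hw0 : 0 ≤ min (t : ℝ) M := le_min ht0.le (Nat.cast_nonneg _)
    have hsα : 0 < √α := Real.sqrt_pos.mpr hα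
    have hst : 0 < √(t : ℝ) := Real.sqrt_pos.mpr ht0
    have h1 : min (t : ℝ) M ≤ √M * √t := by
      calc min (t : ℝ) M = √(min (t : ℝ) M) * √(min (t : ℝ) M) := (Real.mul_self_sqrt hw0).symm
        _ ≤ √M * √t := mul_le_mul (Real.sqrt_le_sqrt (min_le_right _ _))
            (Real.sqrt_le_sqrt (min_le_left _ _)) (Real.sqrt_nonneg _) (Real.sqrt_nonneg _)
    rw [Real.sqrt_mul hα.le, mul_add]
    refine add_le_add ?_ ?_
    · calc min (t : ℝ) M * (a / (√α * √t)) ≤ (√M * √t) * (a / (√α * √t)) := by gcongr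
        _ = √M * a / √α := by field_simp
    · calc min (t : ℝ) M * (b / (α * t)) ≤ t * (b / (α * t)) := by
            gcongr; exact min_le_left _ _
        _ = b / α := by field_simp
  refine (Finset.sum_le_sum hterm).trans_eq ?_
  rw [Finset.sum_const, Nat.card_Icc, Nat.add_sub_cancel, nsmul_eq_mul]

/-- The weighted sum of the rates is, up to a factor, `M T` times the rate at the final time. -/
theorem weighted_rate_le {α a M T : ℝ} (hα : 0 < α) (hMR : 1 ≤ M) (hTR : 1 ≤ T)
    (hMT : T ≤ 4 * M) (ha : 0 ≤ a) :
    T * (√M * a / √α + a ^ 2 / α) ≤ 4 * M * T * (a / √(α * T) + a ^ 2 / (α * T)) := by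
  have hsα : 0 < √α := Real.sqrt_pos.mpr hα
  have hsT : 0 < √T := Real.sqrt_pos.mpr (by linarith)
  have hsM : √T ≤ 2 * √M := by
    rw [show (2 : ℝ) = √4 by rw [show (4 : ℝ) = 2 ^ 2 by norm_num, Real.sqrt_sq (by norm_num)],
      ← Real.sqrt_mul (by norm_num)]
    exact Real.sqrt_le_sqrt hMT
  have hMM : √M * √M = M := Real.mul_self_sqrt (by linarith)
  have e1 : √M * a / √α ≤ 4 * M * (a / √(α * T)) := by
    rw [Real.sqrt_mul hα.le]
    rw [← mul_div_assoc, div_le_div_iff₀ hsα (by positivity)]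
    have : √M * √T ≤ 4 * M := by nlinarith [Real.sqrt_nonneg M]
    calc √M * a * (√α * √T) = (√M * √T) * (a * √α) := by ring
      _ ≤ (4 * M) * (a * √α) := by gcongr
      _ = _ := by ring
  have e2 : a ^ 2 / α ≤ 4 * M * (a ^ 2 / (α * T)) := by
    rw [← mul_div_assoc, div_le_div_iff₀ hα (by positivity)]
    calc a ^ 2 * (α * T) ≤ a ^ 2 * (α * (4 * M)) := by gcongr
      _ = _ := by ring
  calc T * (√M * a / √α + a ^ 2 / α)
      ≤ T * (4 * M * (a / √(α * T)) + 4 * M * (a ^ 2 / (α * T))) := by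
        gcongr
    _ = _ := by ring

theorem one_le_mul_rate {α a L T : ℝ} (hα : 0 < α) (hαL : α ≤ 2 * L) (hTR : 1 ≤ T)
    (ha : 1 ≤ a) : 1 ≤ 2 * L * (T * (a / √(α * T) + a ^ 2 / (α * T))) := by
  have e1 : a ^ 2 / α ≤ T * (a / √(α * T) + a ^ 2 / (α * T)) := by
    have : T * (a ^ 2 / (α * T)) = a ^ 2 / α := by field_simp
    rw [mul_add, this]
    have : 0 ≤ T * (a / √(α * T)) := by positivity
    linarith
  have e2 : 1 ≤ α * (a ^ 2 / α) := by
    rw [mul_div_cancel₀ _ hα.ne']; nlinarith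
  have e3 : 0 ≤ a ^ 2 / α := by positivity
  calc (1 : ℝ) ≤ α * (a ^ 2 / α) := e2
    _ ≤ 2 * L * (a ^ 2 / α) := by gcongr
    _ ≤ _ := by
      have : 0 ≤ 2 * L := by linarith
      gcongr

/-- The bound on the tail average that results from the two recursions, when the error terms decay
like `a / √(α t) + a² / (α t)`. -/
theorem tail_mean_le_of_recursion {T m : ℕ} (hT : 1 ≤ T) (hm : m = T / 2 ∨ m = (T - 1) / 2)
    {α ρ K L a Ca Cu : ℝ} (hα : 0 < α) (hαL : α ≤ 2 * L) (hρ : 0 ≤ ρ) (hρ1 : ρ < 1)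
    (ha : 1 ≤ a) (hCa : 0 ≤ Ca) (hCu : 0 ≤ Cu) {D N gap u q r : ℕ → ℝ}
    (hDN : ∀ t, 1 ≤ t → t < T → D (t + 1) ≤ N t)
    (hD : ∀ t, 1 ≤ t → t ≤ T → 0 ≤ D t) (hN : 0 ≤ N T)
    (h1 : ∀ t, 1 ≤ t → t ≤ T →
      α * t * N t + 2 * gap t ≤ α * (t - 1) * D t + (q t + Cu * u t))
    (h2 : ∀ t, 1 ≤ t → t ≤ T → α * t * N t ≤ α * (t - 2) * D t + (q t + Cu * u t))
    (hu1 : u 1 = 0) (hu : ∀ t, 1 ≤ t → t ≤ T → 0 ≤ u t ∧ u t ≤ K)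
    (hr : ∀ t, 1 ≤ t → t ≤ T → 0 ≤ r t)
    (hrec : ∀ t, 1 ≤ t → t < T → u (t + 1) ≤ ρ * (u t + r t))
    (hq : ∀ t : ℕ, 1 ≤ t → t ≤ T → q t ≤ Ca * (a / √(α * t) + a ^ 2 / (α * t)))
    (hrr : ∀ t : ℕ, 1 ≤ t → t ≤ T → r t ≤ Ca * (a / √(α * t) + a ^ 2 / (α * t))) :
    1 / ((T : ℝ) - m) * ∑ t ∈ Finset.Icc (m + 1) T, gap t
      ≤ (4 * (Ca + 2 * Cu * Ca) + 2 * L * K * Cu) / (1 - ρ)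
        * (a / √(α * T) + a ^ 2 / (α * T)) := by
  set M := max m 1 with hM
  have hM1 : 1 ≤ M := le_max_right _ _
  have hMR : (1 : ℝ) ≤ M := by exact_mod_cast hM1
  have hTR : (1 : ℝ) ≤ T := by exact_mod_cast hT
  have hMT : (T : ℝ) ≤ 4 * M := by
    have : T ≤ 4 * M := by omega
    exact_mod_cast this
  have hTm : (T : ℝ) ≤ 2 * ((T : ℝ) - m) := by
    have h : 2 * m ≤ T := by omega
    have : 2 * (m : ℝ) ≤ T := by exact_mod_cast h
    linarith
  have hK : 0 ≤ K := (hu 1 le_rfl hT).1.trans (hu 1 le_rfl hT).2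
  have hρ' : 0 < 1 - ρ := by linarith
  have hw0 : ∀ t : ℕ, (0 : ℝ) ≤ min (t : ℝ) M := fun t =>
    le_min (Nat.cast_nonneg _) (Nat.cast_nonneg _)
  set P := T * (√M * a / √α + a ^ 2 / α) with hP
  have hP0 : 0 ≤ P := by positivity
  have hsumle : ∀ s : ℕ → ℝ,
      (∀ t : ℕ, 1 ≤ t → t ≤ T → s t ≤ Ca * (a / √(α * t) + a ^ 2 / (α * t))) →
      ∑ t ∈ Finset.Icc 1 T, min (t : ℝ) M * s t ≤ Ca * P := by
    intro s hs
    refine le_trans ?_ (mul_le_mul_of_nonneg_left (sum_weighted_rate_le (T := T) (M := M) hα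
      (by linarith) (sq_nonneg a)) hCa)
    rw [Finset.mul_sum]
    refine Finset.sum_le_sum fun t ht => ?_
    rw [Finset.mem_Icc] at ht
    rw [mul_left_comm]
    exact mul_le_mul_of_nonneg_left (hs t ht.1 ht.2) (hw0 t)
  have hS1 := sum_gap_le_of_recursion hM hα hDN hD hN h1 h2
  have hS2 := sum_consensus_le_of_recursion hT hM1 hρ hρ1 hu1 hu hr hrec
  have hq' := hsumle q hq
  have hr' := hsumle r hrr
  set U := ∑ t ∈ Finset.Icc 1 T, min (t : ℝ) M * u t with hU
  have hsplit : ∑ t ∈ Finset.Icc 1 T, min (t : ℝ) M * (q t + Cu * u t)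
      = ∑ t ∈ Finset.Icc 1 T, min (t : ℝ) M * q t + Cu * U := by
    rw [hU, Finset.mul_sum, ← Finset.sum_add_distrib]
    exact Finset.sum_congr rfl fun t _ => by ring
  rw [hsplit] at hS1
  set S := ∑ t ∈ Finset.Icc (m + 1) T, gap t with hS
  have hmain : (1 - ρ) * (2 * M * S) ≤ (Ca + 2 * Cu * Ca) * P + Cu * K * M := by
    have e1 : (1 - ρ) * (2 * M * S) ≤ (1 - ρ) * (Ca * P + Cu * U) :=
      mul_le_mul_of_nonneg_left (by linarith) hρ'.le
    have e2 : Cu * ((1 - ρ) * U) ≤ Cu * (M * K + 2 * (Ca * P)) :=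
      mul_le_mul_of_nonneg_left (by linarith) hCu
    have e3 : 0 ≤ ρ * (Ca * P) := by positivity
    linarith
  have hPR := weighted_rate_le hα hMR hTR hMT (by linarith : 0 ≤ a)
  have hTR' := one_le_mul_rate hα hαL hTR ha
  rw [← hP] at hPR
  set R := a / √(α * T) + a ^ 2 / (α * T) with hR
  have hR0 : 0 ≤ R := by positivity
  have hbig : (1 - ρ) * (2 * M * S)
      ≤ M * T * ((4 * (Ca + 2 * Cu * Ca) + 2 * L * K * Cu) * R) := by
    have e1 : (Ca + 2 * Cu * Ca) * P ≤ (Ca + 2 * Cu * Ca) * (4 * M * T * R) := by gcongr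
    have e2 : Cu * K * M * 1 ≤ Cu * K * M * (2 * L * (T * R)) := by gcongr
    linarith
  have hM0 : (0 : ℝ) < M := by linarith
  have hS' : (1 - ρ) * (2 * S) ≤ T * ((4 * (Ca + 2 * Cu * Ca) + 2 * L * K * Cu) * R) := by
    refine le_of_mul_le_mul_left ?_ hM0
    linarith
  have hTm0 : 0 < (T : ℝ) - m := by linarith
  have hL0 : 0 ≤ L := by linarith
  have hBR : 0 ≤ (4 * (Ca + 2 * Cu * Ca) + 2 * L * K * Cu) * R := by positivity
  rw [one_div, ← div_eq_inv_mul, div_mul_eq_mul_div, div_le_div_iff₀ hTm0 hρ']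
  have := mul_le_mul_of_nonneg_right hTm hBR
  linarith

/-! ### The smoothing parameter -/

theorem smoothingParam_pos {d : ℕ} (hd : 1 ≤ d) {L α σ : ℝ} (hL : 0 < L) (hα : 0 < α)
    (hσ : 0 < σ) (t : ℕ) : 0 < smoothingParam d L α σ t := by
  have : (0 : ℝ) < d := by exact_mod_cast hd
  exact Real.rpow_pos_of_pos (by positivity) _

theorem smoothingParam_sq_sq {d : ℕ} (hd : 1 ≤ d) {L α σ : ℝ} (hL : 0 < L) (hα : 0 < α)
    (t : ℕ) :
    (smoothingParam d L α σ t ^ 2) ^ 2 * (2 * L * α * t + 9 * L ^ 2 * (d : ℝ) ^ 2)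
      = 3 * (d : ℝ) ^ 2 * σ ^ 2 := by
  have hd0 : (0 : ℝ) < d := by exact_mod_cast hd
  have hden : 0 < 2 * L * α * t + 9 * L ^ 2 * (d : ℝ) ^ 2 := by positivity
  rw [← pow_mul, smoothingParam, ← Real.rpow_natCast, ← Real.rpow_mul (by positivity)]
  norm_num
  field_simp

theorem smoothingParam_sq_le {d : ℕ} (hd : 1 ≤ d) {L α σ : ℝ} (hL : 0 < L) (hα : 0 < α)
    (hσ : 0 < σ) (t : ℕ) : smoothingParam d L α σ t ^ 2 ≤ σ / L := by
  have hd0 : (0 : ℝ) < d := by exact_mod_cast hd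
  have h := smoothingParam_sq_sq hd (σ := σ) hL hα t
  set H := smoothingParam d L α σ t ^ 2
  have h1 : 0 ≤ H ^ 2 * (2 * L * α * t) := by positivity
  have h2 : (d : ℝ) ^ 2 * (H * L) ^ 2 ≤ (d : ℝ) ^ 2 * σ ^ 2 := by
    have : 0 ≤ (d : ℝ) ^ 2 * (H * L) ^ 2 := by positivity
    nlinarith
  have h3 := le_of_mul_le_mul_left h2 (by positivity)
  rw [le_div_iff₀ hL]
  exact le_of_sq_le_sq h3 hσ.le

theorem smoothingParam_le {d : ℕ} (hd : 1 ≤ d) {L α σ : ℝ} (hL : 0 < L) (hα : 0 < α)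
    (hσ : 0 < σ) (t : ℕ) : smoothingParam d L α σ t ≤ 1 + σ / L := by
  have h1 := smoothingParam_sq_le hd hL hα hσ t
  have h2 := smoothingParam_pos hd hL hα hσ t
  nlinarith [sq_nonneg (smoothingParam d L α σ t - 1)]

/-- The smoothing bias decays at the fast rate. -/
theorem smoothingParam_sq_le_rate {d : ℕ} (hd : 1 ≤ d) {L α σ : ℝ} (hL : 0 < L) (hα : 0 < α)
    (hσ : 0 < σ) {t : ℕ} (ht : 1 ≤ t) :
    L * smoothingParam d L α σ t ^ 2 ≤ 2 * σ * √L * ((d : ℝ) / √(α * t)) := by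
  have hd0 : (0 : ℝ) < d := by exact_mod_cast hd
  have ht0 : (0 : ℝ) < t := by exact_mod_cast ht
  have h := smoothingParam_sq_sq hd (σ := σ) hL hα t
  set H := smoothingParam d L α σ t ^ 2
  have hA : 0 < √(α * t) := Real.sqrt_pos.mpr (by positivity)
  rw [← mul_div_assoc, le_div_iff₀ hA]
  refine le_of_sq_le_sq ?_ (by positivity)
  rw [mul_pow, mul_pow, mul_pow, mul_pow, mul_pow, Real.sq_sqrt (by positivity),
    Real.sq_sqrt hL.le]
  have h1 : 0 ≤ H ^ 2 * (9 * L ^ 2 * (d : ℝ) ^ 2) := by positivity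
  have h2 : 2 * (H ^ 2 * L * (α * t)) ≤ 3 * (d : ℝ) ^ 2 * σ ^ 2 := by linarith
  have h3 : 0 ≤ (d : ℝ) ^ 2 * σ ^ 2 * L := by positivity
  have h4 := mul_le_mul_of_nonneg_left h2 hL.le
  linarith

/-- The contribution of the noise to the second moment of the gradient estimator. -/
theorem noise_term_le {d : ℕ} (hd : 1 ≤ d) {L α σ : ℝ} (hL : 0 < L) (hα : 0 < α)
    (hσ : 0 < σ) {t : ℕ} (ht : 1 ≤ t) :
    3 * (d : ℝ) ^ 2 * σ ^ 2 / (2 * smoothingParam d L α σ t ^ 2)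
      ≤ 3 * σ * √L * (d * √(α * t)) + 5 * σ * L * (d : ℝ) ^ 2 := by
  have hd0 : (0 : ℝ) < d := by exact_mod_cast hd
  have ht0 : (0 : ℝ) < t := by exact_mod_cast ht
  have h := smoothingParam_sq_sq hd (σ := σ) hL hα t
  have hH : 0 < smoothingParam d L α σ t ^ 2 := pow_pos (smoothingParam_pos hd hL hα hσ t) 2
  set H := smoothingParam d L α σ t ^ 2
  have hA : 0 < √(α * t) := Real.sqrt_pos.mpr (by positivity)
  have hsL : 0 < √L := Real.sqrt_pos.mpr hL
  refine le_of_sq_le_sq ?_ (by positivity)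
  have e1 : (3 * (d : ℝ) ^ 2 * σ ^ 2 / (2 * H)) ^ 2
      = 3 / 4 * (d : ℝ) ^ 2 * σ ^ 2 * (2 * L * (α * t) + 9 * L ^ 2 * (d : ℝ) ^ 2) := by
    rw [div_pow, div_eq_iff (by positivity)]
    linear_combination (-3 * (d : ℝ) ^ 2 * σ ^ 2) * h
  have e2 : (3 * σ * √L * (d * √(α * t)) + 5 * σ * L * (d : ℝ) ^ 2) ^ 2
      = 9 * σ ^ 2 * L * ((d : ℝ) ^ 2 * (α * t)) + 25 * σ ^ 2 * L ^ 2 * (d : ℝ) ^ 4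
        + 30 * σ ^ 2 * √L * L * (d : ℝ) ^ 3 * √(α * t) := by
    have i1 : √L ^ 2 = L := Real.sq_sqrt hL.le
    have i2 : √(α * t) ^ 2 = α * t := Real.sq_sqrt (by positivity)
    calc _ = 9 * σ ^ 2 * √L ^ 2 * ((d : ℝ) ^ 2 * √(α * t) ^ 2)
          + 25 * σ ^ 2 * L ^ 2 * (d : ℝ) ^ 4
          + 30 * σ ^ 2 * √L * L * (d : ℝ) ^ 3 * √(α * t) := by ring
      _ = _ := by rw [i1, i2]
  rw [e1, e2]
  have p1 : 0 ≤ σ ^ 2 * L * ((d : ℝ) ^ 2 * (α * t)) := by positivity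
  have p2 : 0 ≤ σ ^ 2 * L ^ 2 * (d : ℝ) ^ 4 := by positivity
  have p3 : 0 ≤ 30 * σ ^ 2 * √L * L * (d : ℝ) ^ 3 * √(α * t) := by positivity
  nlinarith

/-- The step size times the second moment of the gradient estimator. -/
theorem stepSize_mul_le {d : ℕ} (hd : 1 ≤ d) {L α σ G s : ℝ} (hL : 0 < L) (hα : 0 < α)
    (hσ : 0 < σ) {t : ℕ} (ht : 1 ≤ t)
    (hs : s ≤ 6 * (d : ℝ) ^ 2 * G ^ 2 + 6 * (d : ℝ) ^ 2 * L ^ 2 * smoothingParam d L α σ t ^ 2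
      + 3 * (d : ℝ) ^ 2 * σ ^ 2 / (2 * smoothingParam d L α σ t ^ 2)) :
    stepSize α t * (1 + s) ≤ (1 + 6 * G ^ 2 + 11 * σ * L) * ((d : ℝ) ^ 2 / (α * t))
      + 3 * σ * √L * ((d : ℝ) / √(α * t)) := by
  have hdR : (1 : ℝ) ≤ d := by exact_mod_cast hd
  have ht0 : (0 : ℝ) < t := by exact_mod_cast ht
  have h1 := noise_term_le hd hL hα hσ ht
  have h2 : L * smoothingParam d L α σ t ^ 2 ≤ σ := by
    have := smoothingParam_sq_le hd hL hα hσ t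
    rwa [le_div_iff₀ hL, mul_comm] at this
  have h3 : 6 * (d : ℝ) ^ 2 * L ^ 2 * smoothingParam d L α σ t ^ 2
      ≤ 6 * (d : ℝ) ^ 2 * L * σ := by
    have := mul_le_mul_of_nonneg_left h2 (by positivity : 0 ≤ 6 * (d : ℝ) ^ 2 * L)
    linarith
  have hA0 : 0 < α * t := by positivity
  have hA : 0 < √(α * t) := Real.sqrt_pos.mpr hA0
  have hAA : √(α * t) * √(α * t) = α * t := Real.mul_self_sqrt hA0.le
  have h4 : 1 + s ≤ (1 + 6 * G ^ 2 + 11 * σ * L) * (d : ℝ) ^ 2 + 3 * σ * √L * (d * √(α * t)) := by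
    have : (1 : ℝ) ≤ (d : ℝ) ^ 2 := one_le_pow₀ hdR
    linarith
  have h5 : (d : ℝ) / √(α * t) = d * √(α * t) / (α * t) := by
    rw [div_eq_div_iff hA.ne' hA0.ne', mul_assoc, hAA]
  rw [stepSize, h5, one_div, ← div_eq_inv_mul, ← mul_div_assoc, ← mul_div_assoc, ← add_div]
  gcongr

/-! ### The run of the algorithm -/

theorem IsStronglyConvex.map_mean_le {d : ℕ} {α : ℝ} {f : Euc d → ℝ} (hα : 0 ≤ α)
    (hf : IsStronglyConvex α f) {ι : Type*} (s : Finset ι) {c : ℝ} (hc : 0 < c)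
    (hcard : (s.card : ℝ) = c) (p : ι → Euc d) :
    f ((1 / c) • ∑ t ∈ s, p t) ≤ (1 / c) * ∑ t ∈ s, f (p t) := by
  set y := (1 / c) • ∑ t ∈ s, p t with hy
  have h1 : ∀ t ∈ s, inner ℝ (gradient f y) (p t - y) ≤ f (p t) - f y := fun t _ => by
    have h := hf.2 (p t) y
    have : 0 ≤ α / 2 * ‖p t - y‖ ^ 2 := by positivity
    linarith
  have h2 := Finset.sum_le_sum h1
  have h3 : ∑ t ∈ s, (p t - y) = 0 := by
    rw [Finset.sum_sub_distrib, Finset.sum_const, ← Nat.cast_smul_eq_nsmul ℝ, hcard, hy, smul_smul,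
      mul_one_div_cancel hc.ne', one_smul, sub_self]
  rw [← inner_sum, h3, inner_zero_right, Finset.sum_sub_distrib, Finset.sum_const, nsmul_eq_mul,
    hcard] at h2
  rw [one_div, ← div_eq_inv_mul, le_div_iff₀ hc]
  linarith

section

variable {d n : ℕ} {Ω : Type*} [MeasurableSpace Ω] {μ : Measure Ω} {f : Fin n → Euc d → ℝ}
  {W : Matrix (Fin n) (Fin n) ℝ} {Θ : Set (Euc d)} {η h : ℕ → ℝ} {T : ℕ} {σ : ℝ}
  {ζ : ℕ → Fin n → Ω → Euc d} {ξ ξ' : ℕ → Fin n → Ω → ℝ} {x : ℕ → Fin n → Ω → Euc d}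

/-- The iterates are random points of `Θ`. -/
theorem IsAlgorithmRun.measurable_and_mem (hrun : IsAlgorithmRun f W Θ η h T ζ ξ ξ' x)
    (hnoise : NoiseAssumption μ σ T ζ ξ ξ' x) (hf : ∀ i, Continuous (f i))
    (hΘ : Convex ℝ Θ) (hc : IsCompact Θ) (hne : Θ.Nonempty)
    (hW : W ∈ doublyStochastic ℝ (Fin n)) {t : ℕ} (ht : 1 ≤ t) (htT : t ≤ T) :
    (∀ i, Measurable (x t i)) ∧ ∀ i ω, x t i ω ∈ Θ := by
  induction t, ht using Nat.le_induction with
  | base => exact ⟨hrun.init_measurable, hrun.init_mem⟩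
  | succ t ht ih =>
    obtain ⟨hm, -⟩ := ih (by omega)
    have hstep := hrun.step t ht (by omega)
    refine ⟨fun i => ?_, fun i ω => ?_⟩
    · rw [funext (hstep i)]
      have hg : ∀ k, Measurable fun ω =>
          gradEstimator (f k) (h t) (x t k ω) (ζ t k ω) (ξ t k ω) (ξ' t k ω) := fun k =>
        measurable_gradEstimator (hf k) _ (hm k) (hnoise.dir_measurable t ht (by omega) k)
          (hnoise.noise_measurable t ht (by omega) k).1
          (hnoise.noise_measurable t ht (by omega) k).2
      have hY : ∀ k, Measurable fun ω => euclProj Θ (x t k ω - η t •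
          gradEstimator (f k) (h t) (x t k ω) (ζ t k ω) (ξ t k ω) (ξ' t k ω)) := fun k =>
        (continuous_euclProj hc hne hΘ).measurable.comp ((hm k).sub ((hg k).const_smul (η t)))
      exact Finset.measurable_fun_sum _ fun k _ => (hY k).const_smul (W i k)
    · rw [hstep]
      exact mix_mem hΘ hW (fun k => (euclProj_spec hc hne _).1) i

theorem IsAlgorithmRun.isStepData (hrun : IsAlgorithmRun f W Θ η h T ζ ξ ξ' x)
    (hnoise : NoiseAssumption μ σ T ζ ξ ξ' x) (hf : ∀ i, Continuous (f i))
    (hΘ : Convex ℝ Θ) (hc : IsCompact Θ) (hne : Θ.Nonempty)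
    (hW : W ∈ doublyStochastic ℝ (Fin n)) {t : ℕ} (ht : 1 ≤ t) (htT : t ≤ T) :
    IsStepData μ σ Θ (x t) (ζ t) (ξ t) (ξ' t) where
  point_measurable := (hrun.measurable_and_mem hnoise hf hΘ hc hne hW ht htT).1
  point_mem := (hrun.measurable_and_mem hnoise hf hΘ hc hne hW ht htT).2
  dir_measurable := hnoise.dir_measurable t ht htT
  dir_law := hnoise.dir_law t ht htT
  noise_measurable := hnoise.noise_measurable t ht htT
  indep := hnoise.indep t ht htT
  noise_memLp := hnoise.noise_memLp t ht htT
  noise_sq_le := hnoise.noise_sq_le t ht htT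

/-- Mixing by a doubly stochastic matrix does not increase the expected mean square
distance of the projected points to `z`. -/
theorem IsStepData.integral_mix_step_le [IsProbabilityMeasure μ] {η h : ℝ}
    {X Z : Fin n → Ω → Euc d} {ξ ξ' : Fin n → Ω → ℝ} (D : IsStepData μ σ Θ X Z ξ ξ')
    (hf : ∀ i, Continuous (f i)) (hΘ : Convex ℝ Θ) (hc : IsCompact Θ) (hne : Θ.Nonempty)
    (hW : W ∈ doublyStochastic ℝ (Fin n)) (z : Euc d) :
    ∫ ω, (1 / (n : ℝ)) * ∑ i, ‖∑ k, W i k • euclProj Θ (X k ω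
        - η • gradEstimator (f k) h (X k ω) (Z k ω) (ξ k ω) (ξ' k ω)) - z‖ ^ 2 ∂μ
      ≤ ∫ ω, (1 / (n : ℝ)) * ∑ k, ‖euclProj Θ (X k ω
        - η • gradEstimator (f k) h (X k ω) (Z k ω) (ξ k ω) (ξ' k ω)) - z‖ ^ 2 ∂μ := by
  set Y : Fin n → Ω → Euc d := fun k ω => euclProj Θ (X k ω
    - η • gradEstimator (f k) h (X k ω) (Z k ω) (ξ k ω) (ξ' k ω)) with hY
  have hYm : ∀ k, Measurable (Y k) := fun k =>
    (continuous_euclProj hc hne hΘ).measurable.comp ((D.point_measurable k).sub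
      ((measurable_gradEstimator (hf k) h (D.point_measurable k) (D.dir_measurable k)
        (D.noise_measurable k).1 (D.noise_measurable k).2).const_smul η))
  have hYΘ : ∀ k ω, Y k ω ∈ Θ := fun k ω => (euclProj_spec hc hne _).1
  refine integral_mono
    (integrable_comp_config hc hYm hYΘ
      (Φ := fun Y => (1 / (n : ℝ)) * ∑ i, ‖∑ k, W i k • Y k - z‖ ^ 2) (by fun_prop))
    (integrable_comp_config hc hYm hYΘ
      (Φ := fun Y => (1 / (n : ℝ)) * ∑ k, ‖Y k - z‖ ^ 2) (by fun_prop))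
    fun ω => mean_norm_mix_sub_sq_le hW _ z

/-- The mean square distance to `z` is the square distance of the average plus the squared consensus
error, of which one factor is bounded by the diameter. -/
theorem IsStepData.integral_mean_norm_sub_sq_le [IsProbabilityMeasure μ] {K : ℝ}
    {X Z : Fin n → Ω → Euc d} {ξ ξ' : Fin n → Ω → ℝ} (D : IsStepData μ σ Θ X Z ξ ξ') (hn : 1 ≤ n)
    (hΘ : Convex ℝ Θ) (hc : IsCompact Θ) (hK : Metric.diam Θ ≤ K) (z : Euc d) :
    ∫ ω, (1 / (n : ℝ)) * ∑ k, ‖X k ω - z‖ ^ 2 ∂μ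
      ≤ ∫ ω, ‖configMean (fun k => X k ω) - z‖ ^ 2 ∂μ
        + K * ∫ ω, consensusError (fun k => X k ω) ∂μ := by
  have hcfg := fun {Φ : (Fin n → Euc d) → ℝ} (hΦ : Continuous Φ) =>
    integrable_comp_config (μ := μ) hc D.point_measurable D.point_mem hΦ
  have hcM := continuous_configMean (d := d) (n := n)
  have hi1 : Integrable (fun ω => (1 / (n : ℝ)) * ∑ k, ‖X k ω - z‖ ^ 2) μ :=
    hcfg (Φ := fun Y => (1 / (n : ℝ)) * ∑ k, ‖Y k - z‖ ^ 2) (by fun_prop)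
  have hi2 : Integrable (fun ω => ‖configMean (fun k => X k ω) - z‖ ^ 2) μ :=
    hcfg (Φ := fun Y => ‖configMean Y - z‖ ^ 2) (by fun_prop)
  have hi3 : Integrable (fun ω => K * consensusError fun k => X k ω) μ :=
    (hcfg continuous_consensusError).const_mul K
  rw [← integral_const_mul, ← integral_add hi2 hi3]
  refine integral_mono hi1 (hi2.add hi3) fun ω => ?_
  have h1 := consensusError_le hΘ hc hK hn fun i => D.point_mem i ω
  have h2 := consensusError_nonneg fun i => X i ω
  simp only [mean_norm_sub_sq hn (fun k => X k ω) z]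
  nlinarith

end

theorem theorem2 (L Lbar G K σ : ℝ) (hL : 0 < L) (hLbar : 0 < Lbar) (hσ : 0 < σ) :
    ∃ B : ℝ, 0 < B ∧
      ∀ (d n : ℕ) (_hd : 1 ≤ d) (_hn : 1 ≤ n) (α : ℝ) (_hα : 0 < α)
        (f : Fin n → Euc d → ℝ)
        (_hconv : IsStronglyConvex α (avgObjective f))
        (_hholder : ∀ i, IsHolderTwo L (f i))
        (_hsmooth : ∀ i, IsTwoSmooth Lbar (f i))
        (W : Matrix (Fin n) (Fin n) ℝ) (_hW : IsConsensusMatrix W)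
        (Θ : Set (Euc d)) (_hΘconv : Convex ℝ Θ) (_hΘcomp : IsCompact Θ)
        (_hdiam : Metric.diam Θ ≤ K)
        (_hgrad : ∀ i, ∀ x ∈ Θ, ‖gradient (f i) x‖ ≤ G)
        (xstar : Euc d) (_hxstar : xstar ∈ Θ) (_hmin : IsMinOn (avgObjective f) Θ xstar)
        (Ω : Type*) [MeasurableSpace Ω] (μ : Measure Ω) [IsProbabilityMeasure μ]
        (T : ℕ) (_hT : 1 ≤ T)
        (ζ : ℕ → Fin n → Ω → Euc d) (ξ ξ' : ℕ → Fin n → Ω → ℝ)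
        (x : ℕ → Fin n → Ω → Euc d)
        (_hrun : IsAlgorithmRun f W Θ (stepSize α) (smoothingParam d L α σ) T ζ ξ ξ' x)
        (_hnoise : NoiseAssumption μ σ T ζ ξ ξ' x)
        (m : ℕ) (_hm : m = T / 2 ∨ m = (T - 1) / 2),
        Integrable (fun ω => avgObjective f (tailAverage x m T ω) - avgObjective f xstar) μ ∧
        ∫ ω, (avgObjective f (tailAverage x m T ω) - avgObjective f xstar) ∂μ ≤
          B / (1 - networkRho W) *
            ((d : ℝ) / Real.sqrt (α * T) + (d : ℝ) ^ 2 / (α * T)) := by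
  -- `C₁` is the price per unit of consensus error of moving the spherical derivatives to the
  -- average (as `h ≤ 1 + σ / L`), `Cu` adds the cost `α K ≤ 2 L K` of replacing `‖x̄ - x*‖ ^ 2` by the
  -- mean square distance, and `Ca` bounds the bias and the second moment relative to the rate.
  set C₁ := G + Lbar * (1 + σ / L) + Lbar * K with hC₁
  set Cu := 2 * C₁ + 4 * L * K with hCu
  set Ca := 1 + 6 * G ^ 2 + 11 * σ * L + 7 * σ * √L with hCa
  refine ⟨max 1 (4 * (Ca + 2 * Cu * Ca) + 2 * L * K * Cu), lt_max_of_lt_left one_pos, ?_⟩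
  intro d n hd hn α hα f hconv hholder hsmooth W hW Θ hΘ hc hK hG xs hxs hmin Ω _ μ _ T hT ζ ξ ξ' x
    hrun hnoise m hm
  have : NeZero d := ⟨by omega⟩
  have hdR : (1 : ℝ) ≤ d := by exact_mod_cast hd
  have hf : ∀ i, ContDiff ℝ 1 (f i) := fun i => (hsmooth i).contDiff
  have hfc : ∀ i, Continuous (f i) := fun i => (hf i).continuous
  have hFc : Continuous (avgObjective f) := (avgObjective_contDiff hf).continuous
  have hK0 : 0 ≤ K := Metric.diam_nonneg.trans hK
  have hG0 : 0 ≤ G := (norm_nonneg _).trans (hG ⟨0, by omega⟩ xs hxs)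
  have hC₁0 : 0 ≤ C₁ := by positivity
  have hCu0 : 0 ≤ Cu := by positivity
  have hCa0 : 0 ≤ Ca := by positivity
  have hαL := strongConvexity_le_two_mul hn hholder hconv
  have hWs := hW.doubly_stochastic
  have hρ0 := networkRho_nonneg W
  have hρ1 := hW.rho_lt_one
  set η := stepSize α with hη
  set h := smoothingParam d L α σ with hh
  have hh0 : ∀ t, 0 < h t := smoothingParam_pos hd hL hα hσ
  have hη0 : ∀ t : ℕ, 0 ≤ η t := fun t => by rw [hη, stepSize]; positivity
  have data : ∀ t, 1 ≤ t → t ≤ T → IsStepData μ σ Θ (x t) (ζ t) (ξ t) (ξ' t) :=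
    fun t ht htT => hrun.isStepData hnoise hfc hΘ hc ⟨xs, hxs⟩ hWs ht htT
  have hcM := continuous_configMean (d := d) (n := n)
  have hgapInt : ∀ t, 1 ≤ t → t ≤ T → Integrable
      (fun ω => avgObjective f (configMean fun k => x t k ω) - avgObjective f xs) μ :=
    fun t ht htT => integrable_comp_config hc (data t ht htT).point_measurable
      (data t ht htT).point_mem (Φ := fun Y => avgObjective f (configMean Y) - avgObjective f xs)
      (by fun_prop)
  set D : ℕ → ℝ := fun t => ∫ ω, (1 / (n : ℝ)) * ∑ k, ‖x t k ω - xs‖ ^ 2 ∂μ with hD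
  set N : ℕ → ℝ := fun t => ∫ ω, (1 / (n : ℝ)) * ∑ k, ‖euclProj Θ (x t k ω - η t •
    gradEstimator (f k) (h t) (x t k ω) (ζ t k ω) (ξ t k ω) (ξ' t k ω)) - xs‖ ^ 2 ∂μ with hN
  set gap : ℕ → ℝ := fun t =>
    ∫ ω, (avgObjective f (configMean fun k => x t k ω) - avgObjective f xs) ∂μ with hgap
  set b : ℕ → ℝ := fun t => ∫ ω, ‖configMean (fun k => x t k ω) - xs‖ ^ 2 ∂μ with hb
  set u : ℕ → ℝ := fun t => ∫ ω, consensusError (fun k => x t k ω) ∂μ with hu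
  set s : ℕ → ℝ := fun t => ∫ ω, (1 / (n : ℝ)) * ∑ k,
    ‖gradEstimator (f k) (h t) (x t k ω) (ζ t k ω) (ξ t k ω) (ξ' t k ω)‖ ^ 2 ∂μ with hs
  have hs0 : ∀ t, 0 ≤ s t := fun t => integral_nonneg fun ω => by positivity
  have hu0 : ∀ t, 0 ≤ u t := fun t => integral_nonneg fun ω => consensusError_nonneg _
  have hrate : ∀ t : ℕ, 1 ≤ t → t ≤ T → η t * (1 + s t)
      ≤ (1 + 6 * G ^ 2 + 11 * σ * L) * ((d : ℝ) ^ 2 / (α * t))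
        + 3 * σ * √L * ((d : ℝ) / √(α * t)) := fun t ht htT =>
    stepSize_mul_le hd hL hα hσ ht
      ((data t ht htT).integral_mean_norm_sq_le hn (hh0 t) hholder hG)
  have hb0 : ∀ t, 1 ≤ t → t ≤ T → α / 2 * b t ≤ gap t := by
    intro t ht htT
    have hi : Integrable (fun ω => ‖configMean (fun k => x t k ω) - xs‖ ^ 2) μ :=
      integrable_comp_config hc (data t ht htT).point_measurable (data t ht htT).point_mem
        (Φ := fun Y => ‖configMean Y - xs‖ ^ 2) (by fun_prop)
    simp only [hb, hgap]
    rw [← integral_const_mul]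
    exact integral_mono (hi.const_mul _) (hgapInt t ht htT) fun ω =>
      hconv.quadratic_growth hΘ hxs hmin
        (configMean_mem hΘ hn fun i => (data t ht htT).point_mem i ω)
  -- The basic inequality of one step, multiplied by `α t = 1 / η t`.
  have hbasic : ∀ t, 1 ≤ t → t ≤ T → α * t * N t + 2 * gap t + α * b t
      ≤ α * t * D t + 2 * (L * h t ^ 2) + η t * (1 + s t) + 2 * C₁ * u t := by
    intro t ht htT
    have ht0 : (0 : ℝ) < t := by exact_mod_cast ht
    have h1 := (data t ht htT).integral_projected_step_le hn hL.le hLbar.le hα.le (hh0 t) (hη0 t)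
      hconv hholder hsmooth hΘ hc hK hG hxs
    change N t ≤ D t - 2 * η t * (gap t + α / 2 * b t - L * h t ^ 2
      - (G + Lbar * h t + Lbar * K) * u t) + η t ^ 2 * s t at h1
    have h2 : (G + Lbar * h t + Lbar * K) * u t ≤ C₁ * u t := by
      have := smoothingParam_le hd hL hα hσ t
      have := hu0 t
      rw [hC₁]
      gcongr
    have hαη : α * t * η t = 1 := by
      rw [hη, stepSize, mul_one_div_cancel (by positivity)]
    have h3 := mul_le_mul_of_nonneg_left h1 (by positivity : 0 ≤ α * t)
    have h4 : α * t * (D t - 2 * η t * (gap t + α / 2 * b t - L * h t ^ 2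
        - (G + Lbar * h t + Lbar * K) * u t) + η t ^ 2 * s t)
        = α * t * D t - 2 * (gap t + α / 2 * b t - L * h t ^ 2
          - (G + Lbar * h t + Lbar * K) * u t) + η t * s t := by
      linear_combination (-2 * (gap t + α / 2 * b t - L * h t ^ 2
        - (G + Lbar * h t + Lbar * K) * u t) + η t * s t) * hαη
    have := hη0 t
    linarith
  have hDb : ∀ t, 1 ≤ t → t ≤ T → α * D t ≤ α * b t + 2 * L * K * u t := by
    intro t ht htT
    have h1 : D t ≤ b t + K * u t :=
      (data t ht htT).integral_mean_norm_sub_sq_le hn hΘ hc hK xs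
    have h2 := mul_le_mul_of_nonneg_left h1 hα.le
    have h3 := mul_le_mul_of_nonneg_right hαL (mul_nonneg hK0 (hu0 t))
    linarith
  have hmainbound := tail_mean_le_of_recursion (D := D) (N := N) (gap := gap) (u := u)
    (q := fun t => 2 * (L * h t ^ 2) + η t * (1 + s t)) (r := fun t => η t * (1 + s t))
    (K := K) hT hm hα hαL hρ0 hρ1 hdR hCa0 hCu0
    (by
      intro t ht htT
      simp only [hD, hrun.step t ht htT]
      exact (data t ht htT.le).integral_mix_step_le hfc hΘ hc ⟨xs, hxs⟩ hWs xs)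
    (fun t _ _ => integral_nonneg fun ω => by positivity)
    (integral_nonneg fun ω => by positivity)
    (by
      intro t ht htT
      have := hbasic t ht htT
      have := hDb t ht htT
      have : 0 ≤ L * K * u t := mul_nonneg (by positivity) (hu0 t)
      rw [hCu]
      linarith)
    (by
      intro t ht htT
      have := hbasic t ht htT
      have := hDb t ht htT
      have := hb0 t ht htT
      rw [hCu]
      linarith)
    (by
      have : ∀ ω, consensusError (fun k => x 1 k ω) = 0 := fun ω => by
        rw [show (fun k => x 1 k ω) = fun _ => x 1 ⟨0, by omega⟩ ω from
          funext fun k => congrFun (hrun.init_eq k _) ω]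
        exact consensusError_const hn _
      simp [hu, this])
    (by
      intro t ht htT
      refine ⟨hu0 t, ?_⟩
      have hi : Integrable (fun ω => consensusError fun k => x t k ω) μ :=
        integrable_comp_config hc (data t ht htT).point_measurable (data t ht htT).point_mem
          continuous_consensusError
      have : u t ≤ ∫ _ω, K ∂μ := integral_mono hi (integrable_const K) fun ω =>
        consensusError_le hΘ hc hK hn fun i => (data t ht htT).point_mem i ω
      simpa using this)
    (fun t _ _ => mul_nonneg (hη0 t) (by linarith [hs0 t]))
    (by
      intro t ht htT
      have := (data t ht htT.le).integral_consensusError_step_le hn (hh0 t) (hη0 t) hholder hΘ hc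
        hG hWs
      simp only [hu, hrun.step t ht htT]
      exact this)
    (by
      intro t ht htT
      have h1 := hrate t ht htT
      have h2 := smoothingParam_sq_le_rate hd hL hα hσ ht
      have h3 : 0 ≤ (d : ℝ) / √(α * t) := by positivity
      have h4 : 0 ≤ (d : ℝ) ^ 2 / (α * t) := by positivity
      have h5 : 0 ≤ (1 + 6 * G ^ 2 + 11 * σ * L) * ((d : ℝ) / √(α * t)) := by positivity
      have h6 : 0 ≤ 7 * σ * √L * ((d : ℝ) ^ 2 / (α * t)) := by positivity
      rw [hCa]
      linarith)
    (by
      intro t ht htT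
      have h1 := hrate t ht htT
      have h5 : 0 ≤ (1 + 6 * G ^ 2 + 11 * σ * L + 4 * σ * √L) * ((d : ℝ) / √(α * t)) := by
        positivity
      have h6 : 0 ≤ 7 * σ * √L * ((d : ℝ) ^ 2 / (α * t)) := by positivity
      rw [hCa]
      linarith)
  have hmT : m + 1 ≤ T := by omega
  have hTm : 0 < (T : ℝ) - m := by
    have : (m : ℝ) + 1 ≤ T := by exact_mod_cast hmT
    linarith
  have hcard : ((Finset.Icc (m + 1) T).card : ℝ) = (T : ℝ) - m := by
    rw [Nat.card_Icc, Nat.add_sub_add_right, Nat.cast_sub (by omega)]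
  have hIcc : ∀ t ∈ Finset.Icc (m + 1) T, 1 ≤ t ∧ t ≤ T := fun t ht => by
    rw [Finset.mem_Icc] at ht; omega
  have hjensen : ∀ ω, avgObjective f (tailAverage x m T ω) - avgObjective f xs
      ≤ 1 / ((T : ℝ) - m) * ∑ t ∈ Finset.Icc (m + 1) T,
        (avgObjective f (configMean fun k => x t k ω) - avgObjective f xs) := by
    intro ω
    have h1 := hconv.map_mean_le hα.le (Finset.Icc (m + 1) T) hTm hcard
      fun t => configMean fun k => x t k ω
    rw [Finset.sum_sub_distrib, Finset.sum_const, nsmul_eq_mul, hcard, mul_sub,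
      ← mul_assoc, one_div_mul_cancel hTm.ne', one_mul]
    exact sub_le_sub_right h1 _
  have htailmem : ∀ ω, tailAverage x m T ω ∈ Θ := by
    intro ω
    rw [tailAverage, Finset.smul_sum]
    refine hΘ.sum_mem (fun _ _ => by positivity) ?_ fun t ht =>
      configMean_mem hΘ hn fun i => (data t (hIcc t ht).1 (hIcc t ht).2).point_mem i ω
    rw [Finset.sum_const, nsmul_eq_mul, hcard, mul_one_div_cancel hTm.ne']
  have htailmeas : Measurable fun ω => tailAverage x m T ω := by
    have h1 : Measurable fun ω => ∑ t ∈ Finset.Icc (m + 1) T, networkAverage x t ω :=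
      Finset.measurable_fun_sum _ fun t ht => hcM.measurable.comp (measurable_pi_lambda _
        (data t (hIcc t ht).1 (hIcc t ht).2).point_measurable)
    exact h1.const_smul (1 / ((T : ℝ) - m))
  have hint : Integrable
      (fun ω => avgObjective f (tailAverage x m T ω) - avgObjective f xs) μ := by
    obtain ⟨C, hC⟩ := hc.exists_bound_of_continuousOn
      (hFc.sub (continuous_const (y := avgObjective f xs))).continuousOn
    exact Integrable.of_bound ((hFc.measurable.comp htailmeas).sub_const _).aestronglyMeasurable
      C (Filter.Eventually.of_forall fun ω => hC _ (htailmem ω))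
  refine ⟨hint, ?_⟩
  have hsumint := integrable_finsetSum (Finset.Icc (m + 1) T) fun t ht =>
    hgapInt t (hIcc t ht).1 (hIcc t ht).2
  have h1 := integral_mono hint (hsumint.const_mul (1 / ((T : ℝ) - m))) hjensen
  rw [integral_const_mul, integral_finsetSum _ fun t ht =>
    hgapInt t (hIcc t ht).1 (hIcc t ht).2] at h1
  refine h1.trans (hmainbound.trans ?_)
  have : 0 < 1 - networkRho W := by linarith
  gcongr
  exact le_max_right _ _
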